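/- Let $p$ be a prime and $m\ge 1$. Differential fields are fields with $m$ commuting derivations $\partial_1,\dots,\partial_m$. Let $U$ be a sufficiently saturated ($\aleph_0$-saturated is enough) model of $\mathrm{DCF}_{p,m}$, that is, an existentially closed differential field of characteristic $p$, in the language of differential rings. Let $K$ be a differential subfield of $U$, let $C_K=\{a\in K:\partial_i(a)=0 \text{ for } 1\le i\le m\}$ be its field of constants, and let $C_K^{1/p}=\{a\in U: a^p\in C_K\}$. Suppose that $K$ is differentially trap, witnessed by $A$: that is, $A\subseteq C_K^{1/p}$ is a $p$-basis of $C_K^{1/p}$ over $K$ (a maximal subset $S$ of $C_K^{1/p}$ such that no $s\in S$ lies in $(C_K^{1/p})^pK(S\setminus\{s\})$), and $A$ is separably differentially independent over $K$, meaning that in the family $(\partial_1^{\alpha_1}\cdots\partial_m^{\alpha_m}a)_{\alpha\in\mathbb N^m,\,a\in A}$ no member is separable algebraic over the field generated over $K$ by the other members. Let $K\langle A\rangle$ be the differential subfield of $U$ generated by $A$ over $K$. Then $K\langle A\rangle$ is differentially perfect, i.e. every differential field extension of $K\langle A\rangle$ is separable. Moreover, $$\operatorname{acl}(K)=K\langle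 A\rangle^{\mathrm{sep}},$$ where $\operatorname{acl}(K)$ is the model-theoretic algebraic closure of $K$ in $U$ and $K\langle A\rangle^{\mathrm{sep}}$ is the separable algebraic closure of $K\langle A\rangle$ in $U$. -/

import Mathlib

open FirstOrder

universe u

/-! ### Fields: compositum with `p`-th powers, separability, `p`-bases -/

/-- The subfield `K ^ p` of `p`-th powers of elements of `K`. -/
noncomputable def Subfield.pthPowers {F : Type*} [Field F] (p : ℕ) [ExpChar F p]
    (K : Subfield F) : Subfield F :=
  K.map (frobenius F p)

/-- The subfield `K ^ (1/p)` of all elements of the ambient field whose `p`-th power is in `K`. -/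
noncomputable def Subfield.pthRoots {F : Type*} [Field F] (p : ℕ) [ExpChar F p]
    (K : Subfield F) : Subfield F :=
  K.comap (frobenius F p)

/-- `K` is linearly disjoint from `L` over `k`, inside the field `F`: every subset of `K` which is
linearly independent over `k` is linearly independent over `L`. (Used for `k ≤ K ⊓ L`.) -/
def Subfield.IsLinearlyDisjoint {F : Type*} [Field F] (k K L : Subfield F) : Prop :=
  ∀ S : Set F, S ⊆ K → LinearIndepOn k id S → LinearIndepOn L id S

/-- The extension `k ⊆ K` of subfields of a field of characteristic `p` is separable
(not necessarily algebraic): `k` is linearly disjoint from `K ^ p` over `k ^ p`. -/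
def Subfield.IsSeparableExt {F : Type*} [Field F] (p : ℕ) [ExpChar F p]
    (k K : Subfield F) : Prop :=
  Subfield.IsLinearlyDisjoint (k.pthPowers p) k (K.pthPowers p)

/-- `S` is `p`-independent over `k` in `K`: no `s ∈ S` lies in `K ^ p k (S \ {s})`. -/
def Subfield.IsPIndependent {F : Type*} [Field F] (p : ℕ) [ExpChar F p]
    (k K : Subfield F) (S : Set F) : Prop :=
  ∀ s ∈ S, s ∉ K.pthPowers p ⊔ k ⊔ Subfield.closure (S \ {s})

/-- `A` is a `p`-basis of `K` over `k`: a maximal subset of `K` that is `p`-independent over `k`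
in `K`. -/
def Subfield.IsPBasis {F : Type*} [Field F] (p : ℕ) [ExpChar F p]
    (k K : Subfield F) (A : Set F) : Prop :=
  Maximal (fun S : Set F => S ⊆ K ∧ Subfield.IsPIndependent p k K S) A

/-- The family `x` is separably independent over `k`: no `x i` is separable algebraic over the
field generated over `k` by the `x j`, `j ≠ i`. (In particular `x` has no repetitions.) -/
def Subfield.IsSeparablyIndependent {F ι : Type*} [Field F] (k : Subfield F) (x : ι → F) : Prop :=
  ∀ i, ¬ IsSeparable ↥(k ⊔ Subfield.closure (x '' {j | j ≠ i})) (x i)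

/-! ### Differential fields with `m` commuting derivations -/

/-- A field equipped with `m` pairwise commuting derivations. -/
class DiffField (m : ℕ) (K : Type*) [Field K] where
  /-- The distinguished derivations. -/
  der : Fin m → Derivation ℤ K K
  der_comm : ∀ i j x, der i (der j x) = der j (der i x)

namespace DiffField

/-- The differential operator `∂₁ ^ α₁ ⋯ ∂ₘ ^ αₘ`. -/
def iterDer {m : ℕ} {K : Type*} [Field K] [DiffField m K] (α : Fin m → ℕ) (x : K) : K :=
  (List.finRange m).foldr (fun i y => (der (m := m) i)^[α i] y) x

/-- The field of absolute constants. -/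
def constants (m : ℕ) (K : Type*) [Field K] [DiffField m K] : Subfield K where
  carrier := {x | ∀ i : Fin m, der i x = 0}
  mul_mem' := by
    intro a b ha hb i
    simp [ha i, hb i]
  one_mem' := by
    intro i
    simp
  add_mem' := by
    intro a b ha hb i
    simp [ha i, hb i]
  zero_mem' := by
    intro i
    simp
  neg_mem' := by
    intro a ha i
    simp [ha i]
  inv_mem' := by
    intro a ha i
    simp [Derivation.leibniz_inv, ha i]

/-- A ring homomorphism of differential fields which commutes with the derivations. -/
def IsDiffHom (m : ℕ) {K L : Type*} [Field K] [DiffField m K] [Field L] [DiffField m L]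
    (f : K →+* L) : Prop :=
  ∀ (i : Fin m) (x : K), f (der i x) = der i (f x)

/-- A differential field `K` of characteristic `p` is differentially perfect if every differential
field extension `f : K → L` is separable. -/
def IsDifferentiallyPerfect (p m : ℕ) [Fact p.Prime] (K : Type u) [Field K] [DiffField m K] :
    Prop :=
  ∀ (L : Type u) [Field L] [CharP L p] [DiffField m L] (f : K →+* L), IsDiffHom m f →
    Subfield.IsSeparableExt p f.fieldRange ⊤

end DiffField

/-- A differential subfield of `U`: a subfield closed under the derivations. -/
structure DiffSubfield (m : ℕ) (U : Type*) [Field U] [DiffField m U] extends Subfield U where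
  der_mem' : ∀ (i : Fin m) {x : U}, x ∈ carrier → DiffField.der i x ∈ carrier

namespace DiffSubfield

variable {m : ℕ} {U : Type*} [Field U] [DiffField m U]

/-- A differential subfield is a differential field with the restricted derivations. -/
instance instDiffField (K : DiffSubfield m U) : DiffField m K.toSubfield where
  der i := Derivation.mk'
    (AddMonoidHom.toIntLinearMap
      { toFun := fun x => ⟨DiffField.der i (x : U), K.der_mem' i x.2⟩
        map_zero' := by ext; simp
        map_add' := by intro x y; ext; simp })
    (by intro a b; ext; simp)
  der_comm i j x := Subtype.ext (DiffField.der_comm i j (x : U))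

/-- The field of constants of `K`, as a subfield of `U`. -/
def constants (K : DiffSubfield m U) : Subfield U :=
  K.toSubfield ⊓ DiffField.constants m U

/-- The differential subfield `K⟨A⟩` of `U` generated by `A` over `K`, that is, the smallest
differential subfield of `U` containing `K` and `A`. -/
def adjoin (K : DiffSubfield m U) (A : Set U) : DiffSubfield m U where
  toSubfield := sInf {E : Subfield U |
    K.toSubfield ≤ E ∧ A ⊆ E ∧ ∀ (i : Fin m), ∀ x ∈ E, DiffField.der i x ∈ E}
  der_mem' i x hx := by
    have hx' := Subfield.mem_sInf.1 hx
    exact Subfield.mem_sInf.2 fun E hE => hE.2.2 i x (hx' E hE)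

/-- `A` is separably differentially independent over `K`: the family of all derivatives
`∂ ^ α a` (for `α ∈ ℕ ^ m` and `a ∈ A`) is separably independent over `K`. -/
def IsSepDiffIndependent (K : DiffSubfield m U) (A : Set U) : Prop :=
  K.toSubfield.IsSeparablyIndependent
    (fun q : (Fin m → ℕ) × A => DiffField.iterDer q.1 (q.2 : U))

end DiffSubfield

/-! ### Model theory -/

/-- The function symbols of the language of differential rings. -/
inductive DiffRingFunc (m : ℕ) : ℕ → Type
  | zero : DiffRingFunc m 0
  | one : DiffRingFunc m 0
  | neg : DiffRingFunc m 1
  | add : DiffRingFunc m 2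
  | mul : DiffRingFunc m 2
  | der (i : Fin m) : DiffRingFunc m 1

/-- The language of differential rings with `m` derivations. -/
def diffRingLanguage (m : ℕ) : Language :=
  ⟨DiffRingFunc m, fun _ => Empty⟩

/-- The natural interpretation of the language in a differential field. -/
instance diffRingStructure (m : ℕ) (K : Type*) [Field K] [DiffField m K] :
    (diffRingLanguage m).Structure K where
  funMap {n} (f : DiffRingFunc m n) :=
    match n, f with
    | _, .zero => fun _ => 0
    | _, .one => fun _ => 1
    | _, .neg => fun v => -v 0
    | _, .add => fun v => v 0 + v 1
    | _, .mul => fun v => v 0 * v 1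
    | _, .der i => fun v => DiffField.der i (v 0)
  RelMap {_} r := Empty.elim r

/-- `U` is a differentially closed field, i.e. an existentially closed differential field: every
quantifier-free formula with parameters in `U` which has a solution in some differential field
extension of `U` has a solution in `U`. When `U` has characteristic `p` these are exactly the
models of the model companion of the theory of fields of characteristic `p` with `m` commuting
derivations. -/
def IsDifferentiallyClosed (m : ℕ) (U : Type u) [Field U] [DiffField m U] : Prop :=
  ∀ (L : Type u) [Field L] [DiffField m L] (f : U →+* L), DiffField.IsDiffHom m f →
    ∀ (n : ℕ) (φ : (diffRingLanguage m).Formula (U ⊕ Fin n)), φ.IsQF →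
      (∃ v : Fin n → L, φ.Realize (Sum.elim f v)) →
        ∃ w : Fin n → U, φ.Realize (Sum.elim id w)

namespace FirstOrder.Language

/-- `M` is `ℵ₀`-saturated: every set of formulas in one variable, with parameters from a finite
tuple `c` of `M`, which is finitely satisfiable in `M` is realized in `M`. -/
def IsAlephZeroSaturated (L : Language) (M : Type*) [L.Structure M] : Prop :=
  ∀ (n : ℕ) (c : Fin n → M) (Γ : Set (L.Formula (Fin n ⊕ Unit))),
    (∀ Γ₀ : Set (L.Formula (Fin n ⊕ Unit)), Γ₀ ⊆ Γ → Γ₀.Finite →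
      ∃ b : M, ∀ φ ∈ Γ₀, φ.Realize (Sum.elim c fun _ => b)) →
    ∃ b : M, ∀ φ ∈ Γ, φ.Realize (Sum.elim c fun _ => b)

/-- The model-theoretic algebraic closure of `B` in `M`: the union of all finite subsets of `M`
that are definable with parameters in `B`. -/
def acl (L : Language) {M : Type*} [L.Structure M] (B : Set M) : Set M :=
  {b | ∃ s : Set M, b ∈ s ∧ s.Finite ∧ B.Definable₁ L s}

end FirstOrder.Language

/-! Put F = K⟨A⟩. Everything rests on one fact: each constant of F is a p-th power in F
(`DiffSubfield.exists_pow_eq_of_mem_adjoin`).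

For this fact, separable independence gives each derivative x_q of an element of A a dual derivation
δ_q of F over K (`IsSepDiffIndependent.exists_dual`). Comparing values on generators shows [δ_{α+e},
∂] = δ_α, where e is the index step of ∂. A given c in F involves finitely many x_q, so δ_q c = 0
for large q; if c is a constant, the commutator carries this vanishing down to every q. By exchange,
c then lies in the compositum of K and F^p (`IsSepDiffIndependent.constants_le`). The p-basis
hypothesis gives C_K ⊆ F^p: U contains the p-th roots of C_K, and these lie in K(A). Since constants
independent over C_K stay independent over K, a constant of that compositum is in F^p
(`mem_of_mem_sup_of_constants`).

The same Wronskian-type argument, applied over F, shows that p-th powers of F-independent elements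
of a differential extension remain F-independent (`LinearIndependent.pow_of_constants`). This yields
differential perfectness, and it also makes U ⊗_F U reduced.

For acl(K) ⊇ F^sep: an element a of A is the only p-th root of a^p ∈ K, so all of F is definable
over K. For the other inclusion, let b be inseparable or transcendental over F and s a finite set.
The product of the 1 ⊗ b - a ⊗ 1 for a ∈ s is nonzero in U ⊗_F U, so some minimal prime omits it.
Minimal primes of a reduced ring are stable under derivations, so the residue field is a
differential field containing two copies of U over F, where the second copy of b avoids the first
copy of s (`DiffSubfield.exists_amalgam`). Existential closedness and saturation bring this back to
some b' ∈ U outside s, and back-and-forth (`DiffAmalgam.realize_iff`) shows that b and b' have the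
same type over finitely many given parameters in F. Hence no formula with these parameters defines a
finite s containing b. -/

/-! ### Quantifier-free conditions, uniform in the differential field -/

namespace FirstOrder.Language.BoundedFormula

theorem IsQF.iInf {L : Language} {α β : Type*} {n : ℕ} [Finite β] {f : β → L.BoundedFormula α n}
    (h : ∀ b, (f b).IsQF) : (BoundedFormula.iInf f).IsQF := by
  let _ := Fintype.ofFinite β
  have key : ∀ l : List (L.BoundedFormula α n), (∀ φ ∈ l, φ.IsQF) →
      (l.foldr (· ⊓ ·) ⊤).IsQF := by
    intro l hl
    induction l with
    | nil => exact IsQF.top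
    | cons φ l ih =>
      exact (hl φ (by simp)).inf (ih fun ψ hψ => hl ψ (by simp [hψ]))
  refine key _ fun φ hφ => ?_
  obtain ⟨b, -, rfl⟩ := List.mem_map.1 hφ
  exact h b

end FirstOrder.Language.BoundedFormula

section QFPred

variable {m : ℕ} {β : Type*}

/-- A uniformly defined relation on differential fields which is expressed by a quantifier-free
formula. -/
def IsQFPred (m : ℕ) {β : Type*}
    (P : ∀ (M : Type u) [Field M] [DiffField m M], (β → M) → Prop) : Prop :=
  ∃ φ : (diffRingLanguage m).Formula β, φ.IsQF ∧
    ∀ (M : Type u) [Field M] [DiffField m M] (v : β → M), φ.Realize v ↔ P M v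

theorem IsQFPred.forall {ι : Type*} [Finite ι]
    {P : ι → ∀ (M : Type u) [Field M] [DiffField m M], (β → M) → Prop}
    (h : ∀ i, IsQFPred m (P i)) : IsQFPred m (fun M _ _ v => ∀ i, P i M v) := by
  choose φ hφ hφ' using h
  refine ⟨Language.Formula.iInf φ, Language.BoundedFormula.IsQF.iInf hφ, fun M _ _ v => ?_⟩
  rw [Language.Formula.realize_iInf]
  exact forall_congr' fun i => hφ' i M v

/-- Here q is a fact of the metatheory that does not depend on M or v: if it fails, the formula is
⊤. -/
theorem IsQFPred.imp {q : Prop}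
    {P : q → ∀ (M : Type u) [Field M] [DiffField m M], (β → M) → Prop}
    (h : ∀ hq, IsQFPred m (P hq)) : IsQFPred m (fun M _ _ v => ∀ hq, P hq M v) := by
  by_cases hq : q
  · obtain ⟨φ, hφ, hφ'⟩ := h hq
    exact ⟨φ, hφ, fun M _ _ v => by simp [hφ' M v, hq]⟩
  · exact ⟨⊤, Language.BoundedFormula.IsQF.top, fun M _ _ v => by simp [hq]⟩

theorem IsQFPred.and {P Q : ∀ (M : Type u) [Field M] [DiffField m M], (β → M) → Prop}
    (hP : IsQFPred m P) (hQ : IsQFPred m Q) : IsQFPred m (fun M _ _ v => P M v ∧ Q M v) := by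
  obtain ⟨φ, hφ, hφ'⟩ := hP
  obtain ⟨ψ, hψ, hψ'⟩ := hQ
  exact ⟨φ ⊓ ψ, hφ.inf hψ, fun M _ _ v => by
    rw [Language.Formula.realize_inf, hφ', hψ']⟩

theorem IsQFPred.not {P : ∀ (M : Type u) [Field M] [DiffField m M], (β → M) → Prop}
    (hP : IsQFPred m P) : IsQFPred m (fun M _ _ v => ¬ P M v) := by
  obtain ⟨φ, hφ, hφ'⟩ := hP
  exact ⟨∼φ, hφ.not, fun M _ _ v => by rw [Language.Formula.realize_not, hφ']⟩

theorem IsQFPred.comap {γ : Type*} {P : ∀ (M : Type u) [Field M] [DiffField m M], (β → M) → Prop}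
    (hP : IsQFPred m P) (g : β → γ) : IsQFPred m (fun M _ _ (v : γ → M) => P M (v ∘ g)) := by
  obtain ⟨φ, hφ, hφ'⟩ := hP
  exact ⟨φ.relabel g, hφ.relabel _, fun M _ _ v => by
    rw [Language.Formula.realize_relabel, hφ']⟩

theorem isQFPred_equal (s t : (diffRingLanguage m).Term β) :
    IsQFPred m (fun M _ _ (v : β → M) => s.realize v = t.realize v) :=
  ⟨s.equal t, .of_isAtomic (.equal _ _), fun M _ _ v => by
    rw [Language.Formula.realize_equal]⟩

open Language

theorem isQFPred_eq (a b : β) : IsQFPred m (fun M _ _ (v : β → M) => v a = v b) :=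
  isQFPred_equal (Term.var a) (Term.var b)

theorem isQFPred_one (a : β) : IsQFPred m (fun M _ _ (v : β → M) => v a = 1) :=
  isQFPred_equal (Term.var a) (Term.func (L := diffRingLanguage m) DiffRingFunc.one ![])

theorem isQFPred_add (a b c : β) : IsQFPred m (fun M _ _ (v : β → M) => v c = v a + v b) :=
  isQFPred_equal (Term.var c)
    (Term.func (L := diffRingLanguage m) DiffRingFunc.add ![Term.var a, Term.var b])

theorem isQFPred_mul (a b c : β) : IsQFPred m (fun M _ _ (v : β → M) => v c = v a * v b) :=
  isQFPred_equal (Term.var c)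
    (Term.func (L := diffRingLanguage m) DiffRingFunc.mul ![Term.var a, Term.var b])

theorem isQFPred_der (i : Fin m) (a b : β) :
    IsQFPred m (fun M _ _ (v : β → M) => v b = DiffField.der i (v a)) :=
  isQFPred_equal (Term.var b)
    (Term.func (L := diffRingLanguage m) (DiffRingFunc.der i) ![Term.var a])

end QFPred

/-! ### Ultrapowers of differential fields -/

section Germ

open Filter

/-- The derivation induced on germs of functions by a derivation. -/
noncomputable def Filter.Germ.mapDerivation {ι R : Type*} (l : Filter ι) [CommRing R]
    (D : Derivation ℤ R R) : Derivation ℤ (l.Germ R) (l.Germ R) :=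
  Derivation.mk' (AddMonoidHom.toIntLinearMap
    { toFun := Germ.map D
      map_zero' := by
        change Germ.map D ((0 : R) : l.Germ R) = ((0 : R) : l.Germ R)
        rw [Germ.map_const, map_zero]
      map_add' := by
        intro x y
        induction x, y using Germ.inductionOn₂ with
        | h f g =>
          rw [← Germ.coe_add, Germ.map_coe, Germ.map_coe, Germ.map_coe, ← Germ.coe_add]
          congr 1; ext; simp })
    (by
      intro x y
      induction x, y using Germ.inductionOn₂ with
      | h f g =>
        simp only [AddMonoidHom.coe_toIntLinearMap, AddMonoidHom.coe_mk, ZeroHom.coe_mk,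
          smul_eq_mul]
        rw [← Germ.coe_mul, Germ.map_coe, Germ.map_coe, Germ.map_coe, ← Germ.coe_mul,
          ← Germ.coe_mul, ← Germ.coe_add]
        congr 1; ext; simp)

noncomputable instance Filter.Germ.instDiffField {ι K : Type*} {m : ℕ} (l : Ultrafilter ι)
    [Field K] [DiffField m K] : DiffField m ((l : Filter ι).Germ K) where
  der i := Germ.mapDerivation _ (DiffField.der i)
  der_comm i j x := by
    induction x using Germ.inductionOn with
    | h f =>
      change Germ.map (DiffField.der (m := m) i)
          (Germ.map (DiffField.der (m := m) j) (Germ.ofFun f)) =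
        Germ.map (DiffField.der (m := m) j) (Germ.map (DiffField.der (m := m) i) (Germ.ofFun f))
      simp only [Germ.map_coe]
      congr 1; ext; exact DiffField.der_comm _ _ _

end Germ

/-! ### Amalgamation, saturation and types -/

section Amalgam

variable {m : ℕ} {U : Type u} [Field U] [DiffField m U]

/-- The tuples `c` and `d` of `U` are identified in a common differential extension, along two
embeddings of `U`. -/
def DiffAmalgam (m : ℕ) {U : Type u} [Field U] [DiffField m U] {ι : Type*} (c d : ι → U) : Prop :=
  ∃ (L : Type u) (_ : Field L) (_ : DiffField m L) (i j : U →+* L),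
    DiffField.IsDiffHom m i ∧ DiffField.IsDiffHom m j ∧ ∀ t, i (d t) = j (c t)

/-- `w` respects all the instances of the operations of differential rings inside of `S`. -/
structure IsLocalDiffHom (m : ℕ) {U M : Type*} [Field U] [DiffField m U] [Field M] [DiffField m M]
    (S : Finset U) (w : S → M) : Prop where
  one : ∀ a : S, (a : U) = 1 → w a = 1
  add : ∀ a b c : S, (c : U) = a + b → w c = w a + w b
  mul : ∀ a b c : S, (c : U) = a * b → w c = w a * w b
  der : ∀ (i : Fin m) (a b : S), (b : U) = DiffField.der i (a : U) → w b = DiffField.der i (w a)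

theorem isQFPred_isLocalDiffHom (S : Finset U) :
    IsQFPred m (fun M _ _ (v : S → M) => IsLocalDiffHom m S v) := by
  have h := ((IsQFPred.forall fun a : S => IsQFPred.imp (q := (a : U) = 1) fun _ =>
    isQFPred_one.{u} (m := m) a).and
    ((IsQFPred.forall fun a : S => IsQFPred.forall fun b : S => IsQFPred.forall fun c : S =>
      IsQFPred.imp (q := (c : U) = a + b) fun _ => isQFPred_add.{u} (m := m) a b c).and
    ((IsQFPred.forall fun a : S => IsQFPred.forall fun b : S => IsQFPred.forall fun c : S =>
      IsQFPred.imp (q := (c : U) = a * b) fun _ => isQFPred_mul.{u} (m := m) a b c).and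
    (IsQFPred.forall fun i : Fin m => IsQFPred.forall fun a : S => IsQFPred.forall fun b : S =>
      IsQFPred.imp (q := (b : U) = DiffField.der i (a : U)) fun _ =>
        isQFPred_der.{u} (m := m) i a b))))
  obtain ⟨φ, hφ, hφ'⟩ := h
  refine ⟨φ, hφ, fun M _ _ v => (hφ' M v).trans ?_⟩
  exact ⟨fun h => ⟨h.1, h.2.1, h.2.2.1, h.2.2.2⟩, fun h => ⟨h.1, h.2, h.3, h.4⟩⟩

-- Compactness by ultrapower: along an ultrafilter on the finite subsets S of U that refines
-- `atTop`, the local maps w S glue to a differential embedding j of U into the ultrapower, while i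
-- is the diagonal.
open Filter in
theorem diffAmalgam_of_isLocalDiffHom {ι : Type*} (c d : ι → U)
    (h : ∀ S : Finset U, ∃ w : S → U, IsLocalDiffHom m S w ∧
      ∀ t (ht : c t ∈ S), w ⟨c t, ht⟩ = d t) : DiffAmalgam m c d := by
  classical
  choose w hw hwd using h
  let l : Ultrafilter (Finset U) := Ultrafilter.of atTop
  have hl : ∀ S : Finset U, ∀ᶠ T in (l : Filter (Finset U)), S ⊆ T := fun S =>
    (Ultrafilter.of_le (atTop : Filter (Finset U))) (eventually_ge_atTop S)
  -- The default 0 has no effect on the germ, since almost every S contains x.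
  let e : U → Finset U → U := fun x S => if hx : x ∈ S then w S ⟨x, hx⟩ else 0
  have he : ∀ {x : U} {S : Finset U} (hx : x ∈ S), e x S = w S ⟨x, hx⟩ := fun hx => dif_pos hx
  let j' : U →* (l : Filter (Finset U)).Germ U :=
    { toFun := fun x => ((e x : Finset U → U) : Germ _ U)
      map_one' := by
        refine Germ.coe_eq.2 ?_
        filter_upwards [hl {1}] with S hS
        have h1 : (1 : U) ∈ S := hS (by simp)
        rw [he h1, (hw S).one _ rfl]
      map_mul' := by
        intro x y
        refine Germ.coe_eq.2 ?_
        filter_upwards [hl {x, y, x * y}] with S hS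
        have hx : x ∈ S := hS (by simp)
        have hy : y ∈ S := hS (by simp)
        have hxy : x * y ∈ S := hS (by simp)
        change _ = e x S * e y S
        rw [he hx, he hy, he hxy]
        exact (hw S).mul _ _ _ rfl }
  let j : U →+* (l : Filter (Finset U)).Germ U := RingHom.mk' j' (by
    intro x y
    refine Germ.coe_eq.2 ?_
    filter_upwards [hl {x, y, x + y}] with S hS
    have hx : x ∈ S := hS (by simp)
    have hy : y ∈ S := hS (by simp)
    have hxy : x + y ∈ S := hS (by simp)
    change _ = e x S + e y S
    rw [he hx, he hy, he hxy]
    exact (hw S).add _ _ _ rfl)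
  let i : U →+* (l : Filter (Finset U)).Germ U :=
    { toFun := fun x => (x : Germ _ U)
      map_one' := rfl
      map_mul' := fun _ _ => rfl
      map_zero' := rfl
      map_add' := fun _ _ => rfl }
  refine ⟨(l : Filter (Finset U)).Germ U, inferInstance, inferInstance, i, j, fun _ _ => rfl,
    fun k x => ?_, fun t => ?_⟩
  · refine Germ.coe_eq.2 ?_
    filter_upwards [hl {x, DiffField.der k x}] with S hS
    have hx : x ∈ S := hS (by simp)
    have hy : DiffField.der k x ∈ S := hS (by simp)
    change _ = DiffField.der k (e x S)
    rw [he hx, he hy]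
    exact (hw S).der _ _ _ rfl
  · refine Germ.coe_eq.2 ?_
    filter_upwards [hl {c t}] with S hS
    rw [he (hS (by simp)), hwd]

/-- A differential homomorphism as an embedding of first-order structures. -/
def diffEmbedding {L : Type*} [Field L] [DiffField m L] (f : U →+* L)
    (hf : DiffField.IsDiffHom m f) : U ↪[diffRingLanguage m] L where
  toFun := f
  inj' := f.injective
  map_fun' {n} g v := by
    cases g with
    | zero => exact map_zero f
    | one => exact map_one f
    | neg => exact map_neg f _
    | add => exact map_add f _ _
    | mul => exact map_mul f _ _
    | der i => exact hf i _
  map_rel' {n} r := Empty.elim r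

/-- An existentially closed differential field solves every finite quantifier-free system over a
finite tuple of unknowns which is solvable in an extension. -/
theorem IsDifferentiallyClosed.exists_of_isQFPred (hU : IsDifferentiallyClosed m U)
    {α β : Type*} [Finite β] {P : ∀ (M : Type u) [Field M] [DiffField m M], (α ⊕ β → M) → Prop}
    (hP : IsQFPred m P) {L : Type u} [Field L] [DiffField m L] (i : U →+* L)
    (hi : DiffField.IsDiffHom m i) (d : α → U) (v : β → L) (h : P L (Sum.elim (i ∘ d) v)) :
    ∃ w : β → U, P U (Sum.elim d w) := by
  obtain ⟨n, ⟨e⟩⟩ := Finite.exists_equiv_fin β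
  obtain ⟨φ, hφ, hφ'⟩ := hP.comap (Sum.map d e)
  obtain ⟨w, hw⟩ := hU L i hi n φ hφ ⟨v ∘ e.symm, by
    rw [hφ']
    convert h using 1
    ext (a | b) <;> simp⟩
  refine ⟨w ∘ e, ?_⟩
  rw [hφ'] at hw
  convert hw using 1
  ext (a | b) <;> simp

theorem exists_realize_of_saturated (hsat : (diffRingLanguage m).IsAlephZeroSaturated U)
    {α ι : Type*} [Finite α] (d : α → U) (φ : ι → (diffRingLanguage m).Formula (α ⊕ Unit))
    (h : ∀ s : Finset ι, ∃ b : U, ∀ k ∈ s, (φ k).Realize (Sum.elim d fun _ => b)) :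
    ∃ b : U, ∀ k, (φ k).Realize (Sum.elim d fun _ => b) := by
  classical
  obtain ⟨n, ⟨e⟩⟩ := Finite.exists_equiv_fin α
  let ψ : ι → (diffRingLanguage m).Formula (Fin n ⊕ Unit) := fun k => (φ k).relabel (Sum.map e id)
  have hψ : ∀ k (b : U), (ψ k).Realize (Sum.elim (d ∘ e.symm) fun _ => b) ↔
      (φ k).Realize (Sum.elim d fun _ => b) := by
    intro k b
    rw [Language.Formula.realize_relabel]
    apply iff_of_eq
    congr 1
    ext (a | b) <;> simp
  obtain ⟨b, hb⟩ := hsat n (d ∘ e.symm) (Set.range ψ) (by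
    intro Γ hΓ hfin
    choose s hs using hΓ
    let T : Finset ι := hfin.toFinset.attach.image fun x => s (hfin.mem_toFinset.1 x.2)
    obtain ⟨b, hb⟩ := h T
    refine ⟨b, fun θ hθ => ?_⟩
    rw [← hs hθ, hψ]
    exact hb _ (Finset.mem_image.2 ⟨⟨θ, hfin.mem_toFinset.2 hθ⟩, Finset.mem_attach _ _, rfl⟩))
  exact ⟨b, fun k => (hψ k b).1 (hb _ ⟨k, rfl⟩)⟩

/-- An element `β` of a differential extension `L` which satisfies a quantifier-free condition over
a finite tuple, and whose type over this tuple is realized by the second embedding of `U`, has a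
copy in `U`. -/
theorem IsDifferentiallyClosed.exists_diffAmalgam (hU : IsDifferentiallyClosed m U)
    (hsat : (diffRingLanguage m).IsAlephZeroSaturated U) {α α₀ : Type*} [Finite α] [Finite α₀]
    {L : Type u} [Field L] [DiffField m L] (i j : U →+* L)
    (hi : DiffField.IsDiffHom m i) (hj : DiffField.IsDiffHom m j) (d : α → U) (β : L)
    (c : α₀ → U) (g : α₀ → α ⊕ Unit) (hc : ∀ t, Sum.elim (i ∘ d) (fun _ => β) (g t) = j (c t))
    {P : ∀ (M : Type u) [Field M] [DiffField m M], (α ⊕ Unit → M) → Prop} (hP : IsQFPred m P)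
    (hβ : P L (Sum.elim (i ∘ d) fun _ => β)) :
    ∃ b : U, P U (Sum.elim d fun _ => b) ∧
      DiffAmalgam m c (fun t => Sum.elim d (fun _ => b) (g t)) := by
  classical
  have hQ : ∀ S : Finset U, IsQFPred m
      (fun M _ _ (v : (α ⊕ Unit) ⊕ S → M) => IsLocalDiffHom m S (fun a => v (Sum.inr a)) ∧
      (∀ t (ht : c t ∈ S), v (Sum.inr ⟨c t, ht⟩) = v (Sum.inl (g t))) ∧
        P M (fun a => v (Sum.inl a))) := fun S =>
    ((isQFPred_isLocalDiffHom S).comap Sum.inr).and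
      ((IsQFPred.forall fun t => IsQFPred.imp fun ht => isQFPred_eq _ _).and (hP.comap Sum.inl))
  choose φ hφ hφ' using hQ
  -- Quantifying out the variables that name a copy of S leaves a formula in the single unknown b
  -- over the tuple d, as saturation requires.
  obtain ⟨b, hb⟩ := exists_realize_of_saturated hsat d (fun S => (φ S).iExs S) (by
    intro s
    -- A solution for the union restricts to each member, so existential closedness is applied once.
    let T : Finset U := s.biUnion id
    have hT : ∀ S ∈ s, S ⊆ T := fun S hS => Finset.subset_biUnion_of_mem id hS
    obtain ⟨w, hw⟩ := hU.exists_of_isQFPred (α := α) (β := Unit ⊕ T)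
      (IsQFPred.comap ⟨φ T, hφ T, hφ' T⟩ (Equiv.sumAssoc _ _ _)) i hi d
      (Sum.elim (fun _ => β) (fun a => j a)) (by
        refine ⟨⟨?_, ?_, ?_, ?_⟩, ?_, ?_⟩
        · intro a ha; simp [ha]
        · intro a b c h; simp [h]
        · intro a b c h; simp [h]
        · intro k a b h; simp [h, hj k]
        · intro t ht
          rw [Function.comp_apply, Function.comp_apply]
          refine (hc t).symm.trans ?_
          rcases g t with a | a <;> rfl
        · convert hβ using 1
          ext (a | a) <;> rfl)
    refine ⟨w (Sum.inl ()), fun S hS => Language.Formula.realize_iExs.2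
      ⟨fun a => w (Sum.inr ⟨a, hT S hS a.2⟩), (hφ' S U _).2 ?_⟩⟩
    obtain ⟨⟨h1, h2, h3, h4⟩, h5, h6⟩ := hw
    have hg : ∀ a : α ⊕ Unit, Sum.elim d w ((Equiv.sumAssoc _ _ _) (Sum.inl a : (α ⊕ Unit) ⊕ T)) =
        Sum.elim d (fun _ => w (Sum.inl ())) a := by
      rintro (a | a) <;> rfl
    let r : S → T := fun a => ⟨a, hT S hS a.2⟩
    refine ⟨⟨fun a => h1 (r a), fun a b c => h2 (r a) (r b) (r c),
      fun a b c => h3 (r a) (r b) (r c), fun k a b => h4 k (r a) (r b)⟩, fun t ht => ?_, ?_⟩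
    · exact (h5 t (hT S hS ht)).trans (hg _)
    · convert h6 using 1
      ext a
      exact (hg a).symm)
  have hb' := fun S => Language.Formula.realize_iExs.1 (hb S)
  refine ⟨b, ?_, diffAmalgam_of_isLocalDiffHom _ _ fun S => ?_⟩
  · obtain ⟨w, hw⟩ := hb' ∅
    exact ((hφ' _ U _).1 hw).2.2
  · obtain ⟨w, hw⟩ := hb' S
    exact ⟨w, ((hφ' _ U _).1 hw).1, ((hφ' _ U _).1 hw).2.1⟩

theorem DiffAmalgam.symm {ι : Type*} {c d : ι → U} (h : DiffAmalgam m c d) : DiffAmalgam m d c := by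
  obtain ⟨L, _, _, i, j, hi, hj, h⟩ := h
  exact ⟨L, _, _, j, i, hj, hi, fun t => (h t).symm⟩

/-- The back-and-forth step: j b already sits in the amalgam next to the first copy of (d, ys), and
saturation finds an element of U that can replace it. -/
theorem DiffAmalgam.exists_snoc (hU : IsDifferentiallyClosed m U)
    (hsat : (diffRingLanguage m).IsAlephZeroSaturated U) {α : Type*} [Finite α] {n : ℕ}
    {c d : α → U} {xs ys : Fin n → U} (h : DiffAmalgam m (Sum.elim c xs) (Sum.elim d ys)) (b : U) :
    ∃ b' : U, DiffAmalgam m (Sum.elim c (Fin.snoc xs b : Fin (n + 1) → U))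
      (Sum.elim d (Fin.snoc ys b' : Fin (n + 1) → U)) := by
  obtain ⟨L, _, _, i, j, hi, hj, h⟩ := h
  let g : α ⊕ Fin (n + 1) → (α ⊕ Fin n) ⊕ Unit :=
    Sum.elim (fun a => Sum.inl (Sum.inl a))
      (Fin.snoc (α := fun _ => (α ⊕ Fin n) ⊕ Unit) (fun k => Sum.inl (Sum.inr k)) (Sum.inr ()))
  obtain ⟨b', -, L', _, _, i', j', hi', hj', h'⟩ := hU.exists_diffAmalgam hsat i j hi hj
    (Sum.elim d ys) (j b) (Sum.elim c (Fin.snoc xs b : Fin (n + 1) → U)) g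
    (by
      rintro (a | k)
      · exact h (Sum.inl a)
      · induction k using Fin.lastCases with
        | last => simp [g]
        | cast k => simpa [g] using h (Sum.inr k))
    (P := fun _ _ _ _ => ∀ k : Empty, False) (IsQFPred.forall nofun) nofun
  refine ⟨b', L', _, _, i', j', hi', hj', ?_⟩
  rintro (a | k)
  · exact h' (Sum.inl a)
  · have := h' (Sum.inr k)
    induction k using Fin.lastCases with
    | last => simpa [g] using this
    | cast k => simpa [g] using this

theorem DiffAmalgam.realize_iff_of_isQF {α : Type*} {n : ℕ}
    {φ : (diffRingLanguage m).BoundedFormula α n} (hφ : φ.IsQF)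
    {c d : α → U} {xs ys : Fin n → U} (h : DiffAmalgam m (Sum.elim c xs) (Sum.elim d ys)) :
    φ.Realize c xs ↔ φ.Realize d ys := by
  obtain ⟨L, _, _, i, j, hi, hj, h⟩ := h
  rw [← hφ.realize_embedding (diffEmbedding j hj), ← hφ.realize_embedding (diffEmbedding i hi)]
  apply iff_of_eq
  congr 1
  · ext a; exact (h (Sum.inl a)).symm
  · ext a; exact (h (Sum.inr a)).symm

/-- In an `ℵ₀`-saturated differentially closed field, tuples that can be amalgamated have the same
type. -/
theorem DiffAmalgam.realize_iff (hU : IsDifferentiallyClosed m U)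
    (hsat : (diffRingLanguage m).IsAlephZeroSaturated U) {α : Type*} [Finite α] {n : ℕ}
    (φ : (diffRingLanguage m).BoundedFormula α n) {c d : α → U} {xs ys : Fin n → U}
    (h : DiffAmalgam m (Sum.elim c xs) (Sum.elim d ys)) :
    φ.Realize c xs ↔ φ.Realize d ys := by
  induction φ generalizing c d with
  | falsum => exact Iff.rfl
  | equal => exact h.realize_iff_of_isQF (.of_isAtomic (.equal _ _))
  | rel R => exact Empty.elim R
  | imp _ _ ih₁ ih₂ => exact imp_congr (ih₁ h) (ih₂ h)
  | all _ ih =>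
    rw [Language.BoundedFormula.realize_all, Language.BoundedFormula.realize_all]
    refine ⟨fun H b => ?_, fun H b => ?_⟩
    · obtain ⟨b', hb'⟩ := h.symm.exists_snoc hU hsat b
      exact (ih hb'.symm).1 (H b')
    · obtain ⟨b', hb'⟩ := h.exists_snoc hU hsat b
      exact (ih hb').2 (H b')

end Amalgam

open scoped TensorProduct

/-! ### Derivations on quotients, fraction fields and tensor products -/

section Derivations

theorem Derivation.exists_of_surjective {R Q : Type*} [CommRing R] [CommRing Q] {q : R →+* Q}
    (hq : Function.Surjective q) (D : Derivation ℤ R R) (hD : ∀ x, q x = 0 → q (D x) = 0) :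
    ∃ D' : Derivation ℤ Q Q, ∀ x, D' (q x) = q (D x) := by
  have key : ∀ x y, q x = q y → q (D x) = q (D y) := fun x y h => by
    rw [← sub_eq_zero, ← map_sub, ← map_sub]
    exact hD _ (by rw [map_sub, h, sub_self])
  choose s hs using hq
  refine ⟨Derivation.mk' (AddMonoidHom.toIntLinearMap
    { toFun := fun x => q (D (s x))
      map_zero' := hD _ (hs 0)
      map_add' := fun x y => by
        rw [key (s (x + y)) (s x + s y) (by simp [hs]), map_add, map_add] }) ?_, fun x => ?_⟩
  · intro x y
    change q (D (s (x * y))) = x * q (D (s y)) + y * q (D (s x))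
    rw [key (s (x * y)) (s x * s y) (by simp [hs])]
    simp [hs]
  · exact key _ _ (hs _)

/-- The ring homomorphism to the dual numbers associated with a derivation. -/
noncomputable def Derivation.toDual {R K : Type*} [CommRing R] [Field K] [Algebra R K]
    (D : Derivation ℤ R R) : R →+* TrivSqZeroExt K K where
  toFun x := TrivSqZeroExt.inl (algebraMap R K x) + TrivSqZeroExt.inr (algebraMap R K (D x))
  map_one' := by ext <;> simp
  map_mul' x y := by ext <;> simp [-DualNumber.inr_eq_smul_eps, mul_comm]
  map_zero' := by ext <;> simp
  map_add' x y := by ext <;> simp [-DualNumber.inr_eq_smul_eps]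

/-- Derivations extend to the field of fractions. -/
theorem Derivation.exists_fractionRing {R K : Type*} [CommRing R] [IsDomain R] [Field K]
    [Algebra R K] [IsFractionRing R K] (D : Derivation ℤ R R) :
    ∃ D' : Derivation ℤ K K, ∀ x, D' (algebraMap R K x) = algebraMap R K (D x) := by
  -- A dual number is a unit once its first component is, so x ↦ x + ε D x extends to fractions; its
  -- second component there is the extended derivation.
  have hu : ∀ y : nonZeroDivisors R, IsUnit (D.toDual (K := K) y) := fun y => by
    rw [TrivSqZeroExt.isUnit_iff_isUnit_fst]
    simp [Derivation.toDual]
  let f : K →+* TrivSqZeroExt K K := IsLocalization.lift hu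
  have hf : ∀ x, f (algebraMap R K x) = D.toDual x := fun x => IsLocalization.lift_eq hu x
  have h1 : ∀ x, (f x).fst = x := by
    have : (TrivSqZeroExt.fstHom K K K : TrivSqZeroExt K K →+* K).comp f = RingHom.id K := by
      refine IsLocalization.ringHom_ext (nonZeroDivisors R) ?_
      ext x
      simp [hf, Derivation.toDual]
    exact fun x => RingHom.congr_fun this x
  refine ⟨Derivation.mk' (AddMonoidHom.toIntLinearMap
    { toFun := fun x => (f x).snd
      map_zero' := by simp
      map_add' := by simp }) ?_, fun x => ?_⟩
  · intro a b
    simp [h1, mul_comm]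
  · change (f (algebraMap R K x)).snd = _
    simp [hf, Derivation.toDual, -DualNumber.inr_eq_smul_eps]

theorem Derivation.ext_of_isFractionRing {R K : Type*} [CommRing R] [IsDomain R] [Field K]
    [Algebra R K] [IsFractionRing R K] {D D' : Derivation ℤ K K}
    (h : ∀ x : R, D (algebraMap R K x) = D' (algebraMap R K x)) : D = D' := by
  ext x
  obtain ⟨a, b, hb, rfl⟩ := IsFractionRing.div_surjective (A := R) x
  have hb' : algebraMap R K b ≠ 0 := by
    simpa using nonZeroDivisors.ne_zero hb
  simp [Derivation.leibniz_div, h]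

/-- Commuting derivations extend to commuting derivations of the field of fractions. -/
theorem exists_diffField_of_isFractionRing {m : ℕ} {R K : Type*} [CommRing R] [IsDomain R] [Field K]
    [Algebra R K] [IsFractionRing R K] (D : Fin m → Derivation ℤ R R)
    (hD : ∀ i j x, D i (D j x) = D j (D i x)) :
    ∃ _ : DiffField m K, ∀ i x, algebraMap R K (D i x) = DiffField.der i (algebraMap R K x) := by
  choose D' hD' using fun i => (D i).exists_fractionRing (K := K)
  have hcomm : ∀ i j, ⁅D' i, D' j⁆ = 0 := by
    intro i j
    refine Derivation.ext_of_isFractionRing (R := R) fun x => ?_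
    rw [Derivation.commutator_apply]
    simp [hD', hD i j x]
  refine ⟨⟨D', fun i j x => ?_⟩, fun i x => (hD' i x).symm⟩
  have := congrArg (fun d : Derivation ℤ K K => d x) (hcomm i j)
  simpa [Derivation.commutator_apply, sub_eq_zero] using this

theorem exists_diffField_of_surjective {m : ℕ} {R Q K : Type*} [CommRing R] [CommRing Q] [IsDomain Q]
    [Field K] [Algebra Q K] [IsFractionRing Q K] {q : R →+* Q} (hq : Function.Surjective q)
    (D : Fin m → Derivation ℤ R R) (hD : ∀ i j x, D i (D j x) = D j (D i x))
    (hDq : ∀ i x, q x = 0 → q (D i x) = 0) :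
    ∃ _ : DiffField m K, ∀ i x,
      algebraMap Q K (q (D i x)) = DiffField.der i (algebraMap Q K (q x)) := by
  choose D' hD' using fun i => (D i).exists_of_surjective hq (hDq i)
  obtain ⟨h, hh⟩ := exists_diffField_of_isFractionRing (K := K) D' (by
      intro i j x
      obtain ⟨x, rfl⟩ := hq x
      simp [hD', hD i j x])
  exact ⟨h, fun i x => by rw [← hh, hD']⟩

/-- A prime ideal stable under commuting derivations is the kernel of a differential homomorphism
to a differential field. -/
theorem exists_diffField_of_isPrime {m : ℕ} {R : Type u} [CommRing R]
    (D : Fin m → Derivation ℤ R R) (hD : ∀ i j x, D i (D j x) = D j (D i x))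
    (P : Ideal R) [P.IsPrime] (hP : ∀ i, ∀ x ∈ P, D i x ∈ P) :
    ∃ (L : Type u) (_ : Field L) (_ : DiffField m L) (q : R →+* L),
      (∀ x, q x = 0 ↔ x ∈ P) ∧ ∀ i x, q (D i x) = DiffField.der i (q x) := by
  obtain ⟨h, hh⟩ := exists_diffField_of_surjective (K := FractionRing (R ⧸ P))
    (Ideal.Quotient.mk_surjective (I := P)) D hD (by
      simpa [Ideal.Quotient.eq_zero_iff_mem] using hP)
  exact ⟨FractionRing (R ⧸ P), inferInstance, h,
    (algebraMap (R ⧸ P) _).comp (Ideal.Quotient.mk P),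
    fun x => by simp [Ideal.Quotient.eq_zero_iff_mem], hh⟩

/-- A reduced ring localized at a minimal prime is a field, so x dies there. Concretely, if no s
works, the monoid generated by x and the complement of P misses 0, and a prime disjoint from it lies
inside P without containing x. -/
theorem Ideal.exists_notMem_mul_eq_zero_of_mem_minimalPrimes {R : Type*} [CommRing R] [IsReduced R]
    {P : Ideal R} (hP : P ∈ minimalPrimes R) {x : R} (hx : x ∈ P) : ∃ s ∉ P, s * x = 0 := by
  have hp : P.IsPrime := hP.1.1
  by_contra! H
  have hdisj : Disjoint ((⊥ : Ideal R) : Set R) (Submonoid.powers x ⊔ P.primeCompl : Submonoid R) := by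
    rw [Set.disjoint_left]
    rintro y hy hyS
    obtain rfl : y = 0 := hy
    obtain ⟨_, ⟨n, rfl⟩, s, hs, h⟩ := Submonoid.mem_sup.1 hyS
    refine H s hs ?_
    refine eq_zero_of_pow_eq_zero (n := n + 1) ?_
    have h' : x ^ n * s = 0 := h
    rw [mul_pow, pow_succ s, pow_succ x]
    linear_combination s ^ n * x * h'
  obtain ⟨Q, hQ, -, hQS⟩ := Ideal.exists_le_prime_disjoint _ _ hdisj
  rw [Set.disjoint_left] at hQS
  have hQP : Q ≤ P := fun y hy => by
    by_contra hyP
    exact hQS hy (Submonoid.mem_sup_right (show y ∈ P.primeCompl from hyP))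
  exact hQS (hP.2 ⟨hQ, bot_le⟩ hQP hx)
    (Submonoid.mem_sup_left (Submonoid.mem_powers x))

/-- Differentiating s x = 0 and multiplying by s gives s² D x = 0 with s outside P. -/
theorem Derivation.apply_mem_of_mem_minimalPrimes {R : Type*} [CommRing R] [IsReduced R]
    (D : Derivation ℤ R R) {P : Ideal R} (hP : P ∈ minimalPrimes R) {x : R} (hx : x ∈ P) :
    D x ∈ P := by
  have hp : P.IsPrime := hP.1.1
  obtain ⟨s, hs, hsx⟩ := Ideal.exists_notMem_mul_eq_zero_of_mem_minimalPrimes hP hx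
  have h := congrArg (fun y => s * D y) hsx
  simp only [D.leibniz, smul_eq_mul, map_zero, mul_zero] at h
  have h2 : s * s * D x = 0 := by linear_combination h - D s * hsx
  have h3 : s * s * D x ∈ P := h2 ▸ P.zero_mem
  exact (hp.mem_or_mem h3).resolve_left fun h => hs ((hp.mem_or_mem h).elim id id)

section Tensor

variable {k A B : Type*} [CommRing k] [CommRing A] [CommRing B]
    [Algebra k A] [Algebra k B] (d : Derivation ℤ k k) (dA : Derivation ℤ A A)
    (dB : Derivation ℤ B B) (hA : ∀ x, dA (algebraMap k A x) = algebraMap k A (d x))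
    (hB : ∀ x, dB (algebraMap k B x) = algebraMap k B (d x))

/-- The additive map underlying `Derivation.tensor`. -/
noncomputable def Derivation.tensorAddHom : A ⊗[k] B →+ A ⊗[k] B :=
  TensorProduct.liftAddHom
    { toFun := fun a =>
        { toFun := fun b => dA a ⊗ₜ b + a ⊗ₜ dB b
          map_zero' := by simp
          map_add' := fun x y => by simp only [map_add, TensorProduct.tmul_add]; abel }
      map_zero' := by ext; simp
      map_add' := fun x y => by
        ext b
        simp only [map_add, TensorProduct.add_tmul, AddMonoidHom.coe_mk, ZeroHom.coe_mk,
          AddMonoidHom.add_apply]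
        abel }
    (fun r a b => by
      have h1 : dA (r • a) = r • dA a + d r • a := by
        simp only [Algebra.smul_def, dA.leibniz, hA, Algebra.algebraMap_self, RingHom.id_apply,
          mul_comm a]
      have h2 : dB (r • b) = r • dB b + d r • b := by
        simp only [Algebra.smul_def, dB.leibniz, hB, Algebra.algebraMap_self, RingHom.id_apply,
          mul_comm b]
      simp only [AddMonoidHom.coe_mk, ZeroHom.coe_mk, h1, h2, TensorProduct.add_tmul,
        TensorProduct.tmul_add, TensorProduct.smul_tmul]
      abel)

theorem Derivation.tensorAddHom_tmul (a : A) (b : B) :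
    d.tensorAddHom dA dB hA hB (a ⊗ₜ b) = dA a ⊗ₜ b + a ⊗ₜ dB b := rfl

/-- The derivation `a ⊗ b ↦ dA a ⊗ b + a ⊗ dB b` on a tensor product. -/
noncomputable def Derivation.tensor : Derivation ℤ (A ⊗[k] B) (A ⊗[k] B) :=
  Derivation.mk' (d.tensorAddHom dA dB hA hB).toIntLinearMap (by
    intro x y
    change d.tensorAddHom dA dB hA hB _ = x * d.tensorAddHom dA dB hA hB y +
      y * d.tensorAddHom dA dB hA hB x
    induction x using TensorProduct.induction_on with
    | zero => simp
    | add x₁ x₂ h₁ h₂ => simp only [add_mul, mul_add, map_add, h₁, h₂]; abel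
    | tmul a b =>
      induction y using TensorProduct.induction_on with
      | zero => simp
      | add x₁ x₂ h₁ h₂ => simp only [add_mul, mul_add, map_add, h₁, h₂]; abel
      | tmul a' b' =>
        simp only [Derivation.tensorAddHom_tmul, Algebra.TensorProduct.tmul_mul_tmul,
          dA.leibniz, dB.leibniz, smul_eq_mul, mul_add,
          TensorProduct.add_tmul, TensorProduct.tmul_add, mul_comm a', mul_comm b']
        abel)

end Tensor

end Derivations

/-! ### Linear independence of constants -/

section Constants

variable {m : ℕ} {M : Type*} [Field M] [DiffField m M]

/-- A family of constants which has no nontrivial relations with constant coefficients in a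
differential subfield `E` is linearly independent over `E`. -/
theorem DiffField.linearIndependent_of_constants (E : Subfield M)
    (hE : ∀ (i : Fin m), ∀ x ∈ E, DiffField.der i x ∈ E) {ι : Type*} {v : ι → M}
    (hv : ∀ (i : Fin m) t, DiffField.der i (v t) = 0)
    (h : ∀ (s : Finset ι) (g : ι → M), (∀ t ∈ s, g t ∈ E ∧ ∀ i : Fin m, DiffField.der i (g t) = 0) →
      ∑ t ∈ s, g t * v t = 0 → ∀ t ∈ s, g t = 0) :
    LinearIndependent E v := by
  classical
  have key : ∀ (s : Finset ι) (g : ι → M), (∀ t ∈ s, g t ∈ E) → ∑ t ∈ s, g t * v t = 0 →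
      ∀ t ∈ s, g t = 0 := by
    intro s
    induction s using Finset.strongInduction with
    | H s ih =>
      intro g hg hsum t₀ ht₀
      by_contra hne
      -- With coefficient 1 at t₀, differentiation removes that term. The shorter relation is
      -- trivial by induction, so all normalized coefficients are constants.
      have hsum' : ∑ t ∈ s, g t / g t₀ * v t = 0 := by
        rw [← zero_div (g t₀), ← hsum, Finset.sum_div]
        exact Finset.sum_congr rfl fun t _ => by ring
      have hder : ∀ (i : Fin m), ∀ t ∈ s, DiffField.der i (g t / g t₀) = 0 := by
        intro i t ht
        rcases eq_or_ne t t₀ with rfl | htt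
        · rw [div_self hne, Derivation.map_one_eq_zero]
        · refine ih (s.erase t₀) (Finset.erase_ssubset ht₀)
            (fun t => DiffField.der i (g t / g t₀))
            (fun t ht => hE i _ (E.div_mem (hg t (Finset.mem_of_mem_erase ht)) (hg t₀ ht₀))) ?_ t
            (Finset.mem_erase.2 ⟨htt, ht⟩)
          have := congrArg (DiffField.der i) hsum'
          simp only [map_sum, Derivation.leibniz, hv, smul_eq_mul, mul_zero, zero_add,
            map_zero] at this
          rw [← Finset.add_sum_erase _ _ ht₀, div_self hne, Derivation.map_one_eq_zero, mul_zero,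
            zero_add] at this
          rw [← this]
          exact Finset.sum_congr rfl fun t _ => mul_comm _ _
      have := h s (fun t => g t / g t₀)
        (fun t ht => ⟨E.div_mem (hg t ht) (hg t₀ ht₀), fun i => hder i t ht⟩) hsum' t₀ ht₀
      rw [div_self hne] at this
      exact one_ne_zero this
  rw [linearIndependent_iff']
  intro s g hg t ht
  exact Subtype.ext (key s (fun t => g t) (fun t _ => (g t).2) hg t ht)

/-- If every constant of `E` is a `p`-th power in `E`, then the `p`-th powers of a linearly
independent family over `E` are linearly independent. -/
theorem LinearIndependent.pow_of_constants (p : ℕ) [Fact p.Prime] [CharP M p] (E : Subfield M)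
    (hE : ∀ (i : Fin m), ∀ x ∈ E, DiffField.der i x ∈ E)
    (hEp : ∀ x ∈ E, (∀ i : Fin m, DiffField.der i x = 0) → ∃ y ∈ E, y ^ p = x)
    {ι : Type*} {v : ι → M} (hv : LinearIndependent E v) :
    LinearIndependent E (fun t => v t ^ p) := by
  refine DiffField.linearIndependent_of_constants E hE (fun i t => ?_) fun s g hg hsum t ht => ?_
  · rw [Derivation.leibniz_pow, nsmul_eq_mul, CharP.cast_eq_zero, zero_mul]
  · have hex : ∀ t, ∃ y : E, t ∈ s → (y : M) ^ p = g t := fun t => by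
      by_cases hts : t ∈ s
      · obtain ⟨y, hy, hyx⟩ := hEp _ (hg t hts).1 (hg t hts).2
        exact ⟨⟨y, hy⟩, fun _ => hyx⟩
      · exact ⟨0, fun h => absurd h hts⟩
    choose y hy using hex
    -- By additivity of Frobenius, the relation among the p-th powers is the p-th power of this one.
    have h0 : ∑ t ∈ s, y t • v t = 0 := by
      refine eq_zero_of_pow_eq_zero (n := p) ?_
      rw [sum_pow_char, ← hsum]
      refine Finset.sum_congr rfl fun t ht => ?_
      rw [← hy t ht, ← mul_pow]; rfl
    rw [← hy t ht, linearIndependent_iff'.1 hv s y h0 t ht]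
    simp [(Fact.out : p.Prime).ne_zero]

end Constants

/-! ### Differential perfectness from p-th roots of constants -/

section Perfect

/-- A differential field whose constants are `p`-th powers is differentially perfect. -/
theorem DiffField.isDifferentiallyPerfect_of_constants (p m : ℕ) [Fact p.Prime] (K : Type u)
    [Field K] [DiffField m K] (h : ∀ x : K, (∀ i : Fin m, der i x = 0) → ∃ y, y ^ p = x) :
    IsDifferentiallyPerfect p m K := by
  classical
  intro L _ _ _ f hf S hS hlin
  have hE : ∀ (i : Fin m), ∀ x ∈ f.fieldRange, der i x ∈ f.fieldRange := by
    rintro i _ ⟨x, rfl⟩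
    exact ⟨der i x, hf i x⟩
  have hEp : ∀ x ∈ f.fieldRange, (∀ i : Fin m, der i x = 0) → ∃ y ∈ f.fieldRange, y ^ p = x := by
    rintro _ ⟨x, rfl⟩ hx
    obtain ⟨y, rfl⟩ := h x fun i => f.injective (by rw [hf, hx, map_zero])
    exact ⟨f y, ⟨y, rfl⟩, (map_pow f y p).symm⟩
  let b := Module.Basis.ofVectorSpace f.fieldRange L
  have hb := b.linearIndependent.pow_of_constants p f.fieldRange hE hEp
  rw [LinearIndepOn, linearIndependent_iff'] at hlin ⊢
  intro s g hg j hj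
  choose l hl hl' using fun t => (g t).2
  let T := s.biUnion fun t => (b.repr (l t)).support
  have hrep : ∀ t ∈ s, l t = ∑ k ∈ T, b.repr (l t) k • b k := by
    intro t ht
    conv_lhs => rw [← b.linearCombination_repr (l t), Finsupp.linearCombination_apply]
    refine Finset.sum_subset (Finset.subset_biUnion_of_mem (fun t => (b.repr (l t)).support) ht) fun k _ hk => ?_
    rw [Finsupp.notMem_support_iff.1 hk]
    exact zero_smul _ _
  -- Expanding the p-th roots l t in the basis b turns the given relation into one among the
  -- independent b k ^ p. Each coefficient is then a relation on S over the p-th powers of the small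
  -- field.
  have hsum : ∑ k ∈ T, (∑ t ∈ s, b.repr (l t) k ^ p * ⟨t, hS t.2⟩ : f.fieldRange) • b k ^ p = 0 := by
    rw [← hg]
    simp only [Finset.sum_smul]
    rw [Finset.sum_comm]
    refine Finset.sum_congr rfl fun t ht => ?_
    have : (g t : L) = ∑ k ∈ T, (b.repr (l t) k : L) ^ p * b k ^ p := by
      rw [← hl' t, frobenius_def]
      conv_lhs => rw [hrep t ht, sum_pow_char]
      exact Finset.sum_congr rfl fun k _ => mul_pow _ _ _
    change _ = (g t : L) * (t : L)
    rw [this, Finset.sum_mul]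
    refine Finset.sum_congr rfl fun k _ => ?_
    change ((b.repr (l t) k : L) ^ p * (t : L)) * _ = _
    ring
  have hzero : ∀ k ∈ T, b.repr (l j) k = 0 := by
    intro k hk
    have h1 := congrArg Subtype.val (linearIndependent_iff'.1 hb T _ hsum k hk)
    have h2 := hlin s (fun t => ⟨(b.repr (l t) k : L) ^ p, ⟨_, (b.repr (l t) k).2, rfl⟩⟩) (by
      rw [AddSubmonoidClass.coe_finsetSum] at h1
      exact h1) j hj
    have h3 := congrArg Subtype.val h2
    exact Subtype.ext (eq_zero_of_pow_eq_zero h3)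
  have : l j = 0 := by
    rw [hrep j hj]
    exact Finset.sum_eq_zero fun k hk => by rw [hzero k hk, zero_smul]
  refine Subtype.ext ?_
  rw [← hl' j, this, map_zero]; rfl

end Perfect

/-! ### Tensor products of fields and separability -/

section Tensor

/-- A tensor product of fields over `k` is reduced if the `p`-th powers of a basis of one of the
factors are linearly independent. -/
theorem TensorProduct.isReduced_of_linearIndependent_pow {k A B ι : Type*} [Field k] [Field A]
    [Field B] [Algebra k A] [Algebra k B] (p : ℕ) [Fact p.Prime] [CharP k p]
    (b : Module.Basis ι k B) (hb : LinearIndependent k fun t => b t ^ p) :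
    IsReduced (A ⊗[k] B) := by
  have : CharP (A ⊗[k] B) p := charP_of_injective_algebraMap (algebraMap k (A ⊗[k] B)).injective p
  rw [isReduced_iff_pow_one_lt p (Fact.out : p.Prime).one_lt]
  intro x hx
  let c := Algebra.TensorProduct.basis A b
  have hlin := Module.Flat.linearIndependent_one_tmul (S := A) hb
  have hx' := c.linearCombination_repr x
  rw [Finsupp.linearCombination_apply, Finsupp.sum] at hx'
  -- This is x ^ p expanded by Frobenius; the 1 ⊗ b t ^ p are still independent over A, so every
  -- coordinate of x has p-th power 0.
  have h0 : ∑ t ∈ (c.repr x).support, (c.repr x t ^ p) • ((1 : A) ⊗ₜ[k] (b t ^ p)) = 0 := by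
    rw [← hx]
    conv_rhs => rw [← hx', sum_pow_char]
    refine Finset.sum_congr rfl fun t _ => ?_
    rw [smul_pow]
    congr 1
    rw [Algebra.TensorProduct.basis_apply, Algebra.TensorProduct.tmul_pow, one_pow]
  have h1 := linearIndependent_iff'.1 hlin _ _ h0
  rw [← hx']
  refine Finset.sum_eq_zero fun t ht => ?_
  rw [eq_zero_of_pow_eq_zero (h1 t ht), zero_smul]

/-- In `A ⊗ B`, a product of elements `1 ⊗ b - a ⊗ 1` with `b` transcendental does not vanish. -/
theorem IsAlgebraic.of_prod_tmul_eq_zero {k A B : Type*} [Field k] [Field A]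
    [Field B] [Algebra k A] [Algebra k B] {b : B} (s : Finset A)
    (h : ∏ a ∈ s, ((1 : A) ⊗ₜ[k] b - a ⊗ₜ[k] (1 : B)) = 0) : IsAlgebraic k b := by
  by_contra hb
  have hlin : LinearIndependent k fun n : ℕ => b ^ n := by
    rw [linearIndependent_iff']
    intro s g hg n hn
    have h0 := transcendental_iff.1 hb (∑ i ∈ s, Polynomial.monomial i (g i)) (by
      rw [map_sum, ← hg]
      exact Finset.sum_congr rfl fun i _ => by rw [Polynomial.aeval_monomial, Algebra.smul_def])
    have := congrArg (Polynomial.coeff · n) h0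
    simpa [Polynomial.finsetSum_coeff, Polynomial.coeff_monomial, hn] using this
  have hlin' := Module.Flat.linearIndependent_one_tmul (S := A) hlin
  -- The product is the monic P evaluated at 1 ⊗ b, whose powers are independent over A when b is
  -- transcendental.
  let P : Polynomial A := ∏ a ∈ s, (Polynomial.X - Polynomial.C a)
  have hP : P.Monic := Polynomial.monic_prod_of_monic _ _ fun a _ => Polynomial.monic_X_sub_C a
  have hPb : Polynomial.aeval ((1 : A) ⊗ₜ[k] b) P = 0 := by
    rw [← h, map_prod]
    refine Finset.prod_congr rfl fun a _ => ?_
    simp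
  rw [Polynomial.aeval_eq_sum_range] at hPb
  have h1 := linearIndependent_iff'.1 hlin' _ _ (by
    simpa [Algebra.TensorProduct.tmul_pow] using hPb) P.natDegree (by simp)
  exact one_ne_zero (hP.symm.trans h1)

/-- An algebraic element is separable if `p`-th powers preserve linear independence over `k`. -/
theorem IsAlgebraic.isSeparable_of_linearIndependent_pow {k B : Type*} [Field k] [Field B]
    [Algebra k B] (p : ℕ) [Fact p.Prime] [CharP k p]
    (hp : ∀ (n : ℕ) (v : Fin n → B), LinearIndependent k v → LinearIndependent k fun t => v t ^ p)
    {b : B} (hb : IsAlgebraic k b) : IsSeparable k b := by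
  have hp' : p.Prime := Fact.out
  rcases Polynomial.separable_or p (minpoly.irreducible hb.isIntegral) with h | ⟨-, g, hg, hgf⟩
  · exact h
  exfalso
  have hdeg : (minpoly k b).natDegree = g.natDegree * p := by
    rw [← hgf, Polynomial.natDegree_expand]
  have hpos := minpoly.natDegree_pos hb.isIntegral
  have hlt : g.natDegree < (minpoly k b).natDegree := by
    rw [hdeg] at hpos ⊢
    exact lt_mul_of_one_lt_right (Nat.pos_of_mul_pos_right hpos) hp'.one_lt
  -- As deg g is below the degree of b, this is a relation among the p-th powers of the independent
  -- elements 1, b, b², …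
  have hz : Polynomial.aeval (b ^ p) g = 0 := by
    rw [← Polynomial.expand_aeval, hgf, minpoly.aeval]
  rw [Polynomial.aeval_eq_sum_range' hlt, Finset.sum_range] at hz
  have h1 := linearIndependent_iff'.1 (hp _ _ (linearIndependent_pow (K := k) b)) Finset.univ
    (fun i => g.coeff i) (by
      rw [← hz]
      exact Finset.sum_congr rfl fun i _ => by rw [← pow_mul, ← pow_mul, mul_comm])
    ⟨g.natDegree, hlt⟩ (Finset.mem_univ _)
  exact hg.ne_zero (Polynomial.leadingCoeff_eq_zero.1 h1)

end Tensor

/-! ### Two copies of U over a differential subfield -/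

section Amalgam

variable {m : ℕ} {U : Type u} [Field U] [DiffField m U]

/-- Let `F` be a differential subfield of `U` whose constants are `p`-th powers. Two copies of `U`
can be amalgamated over `F` such that the second copy of a given `b`, not separably algebraic over
`F`, avoids the first copy of a given finite set. -/
theorem DiffSubfield.exists_amalgam (p : ℕ) [Fact p.Prime] [CharP U p] (F : DiffSubfield m U)
    (hF : ∀ x ∈ F.toSubfield, (∀ i : Fin m, DiffField.der i x = 0) → ∃ y ∈ F.toSubfield, y ^ p = x)
    {b : U} (hb : ¬ IsSeparable F.toSubfield b) (s : Finset U) :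
    ∃ (L : Type u) (_ : Field L) (_ : DiffField m L) (i j : U →+* L),
      DiffField.IsDiffHom m i ∧ DiffField.IsDiffHom m j ∧ (∀ x ∈ F.toSubfield, i x = j x) ∧
        ∀ a ∈ s, j b ≠ i a := by
  have hpow : ∀ {ι : Type u} {v : ι → U}, LinearIndependent F.toSubfield v →
      LinearIndependent F.toSubfield fun t => v t ^ p := fun hv =>
    hv.pow_of_constants p F.toSubfield (fun i x hx => F.der_mem' i hx) hF
  have : CharP F.toSubfield p := (algebraMap F.toSubfield U).charP
    (algebraMap F.toSubfield U).injective p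
  let T := U ⊗[F.toSubfield] U
  have hred : IsReduced T :=
    TensorProduct.isReduced_of_linearIndependent_pow p (Module.Basis.ofVectorSpace F.toSubfield U)
      (hpow (Module.Basis.linearIndependent _))
  let D : Fin m → Derivation ℤ T T := fun i =>
    (DiffField.der i : Derivation ℤ F.toSubfield F.toSubfield).tensor (DiffField.der i)
      (DiffField.der i) (fun _ => rfl) (fun _ => rfl)
  have hDt : ∀ i x y, D i (x ⊗ₜ y) = DiffField.der i x ⊗ₜ y + x ⊗ₜ DiffField.der i y :=
    fun _ _ _ => rfl
  have hD : ∀ i j x, D i (D j x) = D j (D i x) := by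
    intro i j x
    induction x using TensorProduct.induction_on with
    | zero => simp
    | add x y hx hy => simp only [map_add, hx, hy]
    | tmul x y =>
      simp only [hDt, map_add, DiffField.der_comm i j]
      abel
  have hz : ∏ a ∈ s, ((1 : U) ⊗ₜ[F.toSubfield] b - a ⊗ₜ[F.toSubfield] (1 : U)) ≠ 0 := fun h =>
    hb ((IsAlgebraic.of_prod_tmul_eq_zero s h).isSeparable_of_linearIndependent_pow p
      fun n v hv => by
        have := hpow (v := fun t : ULift (Fin n) => v t.down)
          (hv.comp _ ULift.down_injective)
        exact this.comp ULift.up ULift.up_injective)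
  -- The minimal primes intersect in the nilradical, which is zero because T is reduced.
  obtain ⟨P, hP, hzP⟩ : ∃ P ∈ minimalPrimes T,
      ∏ a ∈ s, ((1 : U) ⊗ₜ[F.toSubfield] b - a ⊗ₜ[F.toSubfield] (1 : U)) ∉ P := by
    by_contra! H
    have h1 := Submodule.mem_sInf.2 H
    rw [minimalPrimes, Ideal.sInf_minimalPrimes] at h1
    obtain ⟨n, hn⟩ := h1
    exact hz (eq_zero_of_pow_eq_zero hn)
  have hPp : P.IsPrime := hP.1.1
  obtain ⟨L, _, _, q, hq, hqD⟩ := exists_diffField_of_isPrime D hD P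
    fun i x hx => (D i).apply_mem_of_mem_minimalPrimes hP hx
  refine ⟨L, inferInstance, inferInstance,
    q.comp (Algebra.TensorProduct.includeLeft : U →ₐ[F.toSubfield] T).toRingHom,
    q.comp (Algebra.TensorProduct.includeRight : U →ₐ[F.toSubfield] T).toRingHom,
    fun i x => ?_, fun i x => ?_, fun x hx => ?_, fun a ha h => ?_⟩
  · refine (congrArg q (Eq.trans ?_ (hDt i x 1).symm)).trans (hqD i (x ⊗ₜ 1))
    rw [Derivation.map_one_eq_zero, TensorProduct.tmul_zero, add_zero]; rfl
  · refine (congrArg q (Eq.trans ?_ (hDt i 1 x).symm)).trans (hqD i (1 ⊗ₜ x))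
    rw [Derivation.map_one_eq_zero, TensorProduct.zero_tmul, zero_add]; rfl
  · change q (x ⊗ₜ 1) = q (1 ⊗ₜ x)
    have := TensorProduct.smul_tmul (R := F.toSubfield) (⟨x, hx⟩ : F.toSubfield) (1 : U) (1 : U)
    simp only [Subfield.smul_def, smul_eq_mul, mul_one] at this
    rw [this]
  · change q (1 ⊗ₜ b) = q (a ⊗ₜ 1) at h
    rw [← sub_eq_zero, ← map_sub, hq] at h
    exact hzP (P.mem_of_dvd (Finset.dvd_prod_of_mem _ ha) h)

end Amalgam

/-! ### Adjoining p-th roots of constants -/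

section PthRoots

open Polynomial Language

theorem exists_term_pow (m : ℕ) {β : Type*} (a : β) (n : ℕ) :
    ∃ t : (diffRingLanguage m).Term β, ∀ (M : Type u) [Field M] [DiffField m M] (v : β → M),
      t.realize v = v a ^ n := by
  induction n with
  | zero =>
    refine ⟨Term.func (L := diffRingLanguage m) DiffRingFunc.one ![], fun M _ _ v => ?_⟩
    rw [pow_zero]; rfl
  | succ n ih =>
    obtain ⟨t, ht⟩ := ih
    refine ⟨Term.func (L := diffRingLanguage m) DiffRingFunc.mul ![t, Term.var a],
      fun M _ _ v => ?_⟩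
    rw [pow_succ, ← ht M v]; rfl

theorem isQFPred_pow {m : ℕ} {β : Type*} (a b : β) (n : ℕ) :
    IsQFPred m (fun (M : Type u) _ _ (v : β → M) => v a ^ n = v b) := by
  obtain ⟨t, ht⟩ := exists_term_pow.{u} m a n
  obtain ⟨φ, hφ, hφ'⟩ := isQFPred_equal (m := m) t (Term.var b)
  exact ⟨φ, hφ, fun M _ _ v => (hφ' M v).trans (by dsimp only; rw [ht]; rfl)⟩

/-- Let the derivations act on U[X] coefficientwise, so that X is a constant. They kill the
irreducible X ^ p - c, hence preserve the prime ideal it generates. -/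
theorem DiffField.exists_extension_pow_eq {m : ℕ} {U : Type u} [Field U] [DiffField m U] (p : ℕ)
    [Fact p.Prime] [CharP U p] {c : U} (hc : ∀ i : Fin m, der i c = 0) (hcp : ∀ b : U, b ^ p ≠ c) :
    ∃ (L : Type u) (_ : Field L) (_ : DiffField m L) (f : U →+* L), IsDiffHom m f ∧
      ∃ y, y ^ p = f c := by
  have hirr := X_pow_sub_C_irreducible_of_prime (Fact.out : p.Prime) hcp
  have hprime : (Ideal.span {X ^ p - C c}).IsPrime :=
    (Ideal.span_singleton_prime hirr.ne_zero).2 hirr.prime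
  let D : Fin m → Derivation ℤ U[X] U[X] := fun i =>
    letI : Differential U := ⟨der i⟩
    Differential.mapCoeffs
  have hD : ∀ i (f : U[X]) n, (D i f).coeff n = der i (f.coeff n) := fun _ _ _ => rfl
  have hDf : ∀ i, D i (X ^ p - C c) = 0 := by
    intro i
    ext n
    rw [hD, coeff_sub, coeff_X_pow, coeff_C, map_sub, coeff_zero]
    split_ifs <;> simp [hc]
  have hDC : ∀ i x, D i (C x) = C (der i x) := by
    intro i x
    ext n
    rw [hD, coeff_C, coeff_C]
    split_ifs <;> simp
  obtain ⟨L, _, _, q, hq, hqD⟩ := exists_diffField_of_isPrime D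
    (fun i j x => by ext n; exact (der_comm i j (x.coeff n))) (Ideal.span {X ^ p - C c})
    (fun i x hx => by
      rw [Ideal.mem_span_singleton] at hx ⊢
      obtain ⟨g, rfl⟩ := hx
      refine Dvd.intro (D i g) (Eq.symm (((D i).leibniz _ g).trans ?_))
      rw [hDf, smul_zero, add_zero, smul_eq_mul])
  refine ⟨L, inferInstance, inferInstance, q.comp C,
    fun i x => (congrArg q (hDC i x)).symm.trans (hqD i (C x)), q X, ?_⟩
  rw [RingHom.comp_apply, ← map_pow, ← sub_eq_zero, ← map_sub, hq]
  exact Ideal.mem_span_singleton_self _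

/-- In a differentially closed field of characteristic `p`, constants are `p`-th powers. -/
theorem IsDifferentiallyClosed.exists_pow_eq {m : ℕ} {U : Type u} [Field U] [DiffField m U]
    (hU : IsDifferentiallyClosed m U) (p : ℕ) [Fact p.Prime] [CharP U p] {c : U}
    (hc : ∀ i : Fin m, DiffField.der i c = 0) : ∃ y, y ^ p = c := by
  by_contra! H
  obtain ⟨L, _, _, f, hf, y, hy⟩ := DiffField.exists_extension_pow_eq p hc H
  obtain ⟨w, hw⟩ := hU.exists_of_isQFPred
    (isQFPred_pow (Sum.inr () : Unit ⊕ Unit) (Sum.inl ()) p) f hf (fun _ => c) (fun _ => y) hy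
  exact H _ hw

end PthRoots

/-! ### Purely inseparable exchange and dual derivations -/

section Exchange

open IntermediateField Polynomial

theorem Subfield.sup_closure_singleton {F : Type*} [Field F] (G : Subfield F) (x : F) :
    G ⊔ Subfield.closure {x} = (IntermediateField.adjoin G {x}).toSubfield := by
  rw [IntermediateField.adjoin_toSubfield, Subfield.closure_union]
  congr 1
  have : Set.range (algebraMap G F) = G := Subtype.range_coe
  rw [this, Subfield.closure_eq]

theorem Subfield.finrank_adjoin_of_pow_mem {F : Type*} [Field F] (p : ℕ) [Fact p.Prime] [CharP F p]
    {G : Subfield F} {x : F} (hx : x ^ p ∈ G) (hxG : x ∉ G) :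
    IsIntegral G x ∧ Module.finrank G G⟮x⟯ = p := by
  have hirr : Irreducible (X ^ p - C (⟨x ^ p, hx⟩ : G)) :=
    X_pow_sub_C_irreducible_of_prime Fact.out fun b hb => hxG (by
      have h1 : (b : F) ^ p = x ^ p := congrArg Subtype.val hb
      rw [← frobenius_inj F p h1]
      exact b.2)
  have hmonic := monic_X_pow_sub_C (⟨x ^ p, hx⟩ : G) (Fact.out : p.Prime).ne_zero
  have hroot : aeval x (X ^ p - C (⟨x ^ p, hx⟩ : G)) = 0 := by
    simp [show algebraMap G F ⟨x ^ p, hx⟩ = x ^ p from rfl]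
  have hint : IsIntegral G x := ⟨_, hmonic, hroot⟩
  refine ⟨hint, ?_⟩
  rw [adjoin.finrank hint, ← minpoly.eq_of_irreducible_of_monic hirr hroot hmonic,
    natDegree_X_pow_sub_C]

/-- Exchange property for purely inseparable extensions of exponent one. -/
theorem Subfield.mem_sup_closure_of_pow_mem {F : Type*} [Field F] (p : ℕ) [Fact p.Prime] [CharP F p]
    {G : Subfield F} {x c : F} (hx : x ^ p ∈ G) (hc : c ∈ G ⊔ Subfield.closure {x}) (hcG : c ∉ G) :
    x ∈ G ⊔ Subfield.closure {c} := by
  have hxG : x ∉ G := fun h => hcG (by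
    have : G ⊔ Subfield.closure {x} ≤ G := sup_le le_rfl (Subfield.closure_le.2 (by simpa using h))
    exact this hc)
  obtain ⟨hint, hfin⟩ := Subfield.finrank_adjoin_of_pow_mem p hx hxG
  rw [Subfield.sup_closure_singleton] at hc ⊢
  have hc' : c ∈ G⟮x⟯ := hc
  have hle : G⟮c⟯ ≤ G⟮x⟯ := adjoin_simple_le_iff.2 hc'
  -- The degree of G(c) divides the prime p, and it is not 1 because c is outside G.
  have hdvd := finrank_dvd_of_le_right hle
  rw [hfin, Nat.dvd_prime Fact.out] at hdvd
  have : FiniteDimensional G G⟮x⟯ := adjoin.finiteDimensional hint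
  rcases hdvd with h1 | h1
  · rw [finrank_adjoin_simple_eq_one_iff, IntermediateField.mem_bot] at h1
    obtain ⟨y, rfl⟩ := h1
    exact absurd y.2 hcG
  · rw [eq_of_le_of_finrank_eq hle (h1.trans hfin.symm)]
    exact mem_adjoin_simple_self G x

end Exchange

section DerivationsOn

variable {U : Type*} [Field U]

/-- `δ` restricts to a derivation on the subfield `F`, with values in the ambient field. -/
structure IsDerivationOn (F : Subfield U) (δ : U → U) : Prop where
  add : ∀ x ∈ F, ∀ y ∈ F, δ (x + y) = δ x + δ y
  mul : ∀ x ∈ F, ∀ y ∈ F, δ (x * y) = x * δ y + y * δ x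

namespace IsDerivationOn

variable {F : Subfield U} {δ : U → U}

theorem map_zero (h : IsDerivationOn F δ) : δ 0 = 0 := by
  simpa using h.add 0 F.zero_mem 0 F.zero_mem

theorem map_one (h : IsDerivationOn F δ) : δ 1 = 0 := by
  simpa using h.mul 1 F.one_mem 1 F.one_mem

theorem map_neg (h : IsDerivationOn F δ) {x : U} (hx : x ∈ F) : δ (-x) = -δ x := by
  have := h.add x hx (-x) (F.neg_mem hx)
  rw [add_neg_cancel, h.map_zero] at this
  linear_combination -this

theorem map_pow (h : IsDerivationOn F δ) {x : U} (hx : x ∈ F) (n : ℕ) :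
    δ (x ^ n) = n * x ^ (n - 1) * δ x := by
  induction n with
  | zero => simp [h.map_one]
  | succ n ih =>
    rw [pow_succ, h.mul _ (F.pow_mem hx n) _ hx, ih]
    rcases n with _ | n
    · simp
    · simp only [Nat.add_sub_cancel, Nat.cast_add, Nat.cast_one]
      ring

/-- The elements of `F` annihilated by a derivation on `F`. -/
def ker (h : IsDerivationOn F δ) : Subfield U where
  carrier := {x | x ∈ F ∧ δ x = 0}
  mul_mem' := fun {x y} hx hy =>
    ⟨F.mul_mem hx.1 hy.1, by rw [h.mul x hx.1 y hy.1, hx.2, hy.2, mul_zero, mul_zero, add_zero]⟩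
  one_mem' := ⟨F.one_mem, h.map_one⟩
  add_mem' := fun {x y} hx hy =>
    ⟨F.add_mem hx.1 hy.1, by rw [h.add x hx.1 y hy.1, hx.2, hy.2, add_zero]⟩
  zero_mem' := ⟨F.zero_mem, h.map_zero⟩
  neg_mem' := fun {x} hx => ⟨F.neg_mem hx.1, by rw [h.map_neg hx.1, hx.2, neg_zero]⟩
  inv_mem' := fun x hx => ⟨F.inv_mem hx.1, by
    rcases eq_or_ne x 0 with rfl | hx0
    · rw [inv_zero, h.map_zero]
    · have := h.mul x hx.1 x⁻¹ (F.inv_mem hx.1)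
      rw [mul_inv_cancel₀ hx0, h.map_one, hx.2, mul_zero, add_zero] at this
      exact (mul_eq_zero.1 this.symm).resolve_left hx0⟩

end IsDerivationOn

open IntermediateField in
/-- An element `x` which is not separable over `G` has a dual derivation over `G`. -/
theorem exists_isDerivationOn_of_not_isSeparable {G : Subfield U} {x : U}
    (hx : ¬ IsSeparable G x) :
    ∃ δ : U → U, IsDerivationOn (G ⊔ Subfield.closure {x}) δ ∧ (∀ y ∈ G, δ y = 0) ∧ δ x = 1 := by
  classical
  rw [Subfield.sup_closure_singleton]
  let g : G⟮x⟯ := AdjoinSimple.gen G x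
  let d := KaehlerDifferential.D G G⟮x⟯
  have hg : d g ≠ 0 := by
    -- If dx = 0, all Kähler differentials of G(x) over G vanish; an essentially finite type field
    -- extension with this property is separable.
    intro h0
    refine hx ((isSeparable_adjoin_simple_iff_isSeparable G U).1 ?_)
    have : Algebra.EssFiniteType G G⟮x⟯ := essFiniteType_iff.2 ⟨{x}, by simp⟩
    have hd : ∀ y (hy : y ∈ G⟮x⟯), d ⟨y, hy⟩ = 0 := by
      intro y hy
      induction hy using adjoin_induction with
      | mem y hy =>
        obtain rfl : y = x := hy
        exact h0
      | algebraMap y => exact d.map_algebraMap y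
      | add y z hy hz h1 h2 => exact (d.map_add ⟨y, hy⟩ ⟨z, hz⟩).trans (by rw [h1, h2, add_zero])
      | inv y hy h1 => exact (d.leibniz_inv ⟨y, hy⟩).trans (by rw [h1, smul_zero])
      | mul y z hy hz h1 h2 =>
        exact (d.leibniz ⟨y, hy⟩ ⟨z, hz⟩).trans (by rw [h1, h2, smul_zero, smul_zero, add_zero])
    rw [← Algebra.FormallyUnramified.iff_isSeparable]
    refine ⟨?_⟩
    rw [← Submodule.subsingleton_iff G⟮x⟯, ← subsingleton_iff_bot_eq_top,
      ← KaehlerDifferential.span_range_derivation, eq_comm, Submodule.span_eq_bot]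
    rintro _ ⟨y, rfl⟩
    exact hd y y.2
  obtain ⟨φ, hφ⟩ : ∃ φ : Module.Dual G⟮x⟯ (Ω[G⟮x⟯⁄G]), φ (d g) ≠ 0 := by
    by_contra! H
    exact hg ((Module.forall_dual_apply_eq_zero_iff G⟮x⟯ _).1 H)
  let ε : G⟮x⟯ → G⟮x⟯ := fun y => (φ (d g))⁻¹ * φ (d y)
  have hδ : ∀ {y : U} (hy : y ∈ G⟮x⟯),
      (if h : y ∈ G⟮x⟯ then (ε ⟨y, h⟩ : U) else 0) = ε ⟨y, hy⟩ := fun hy => dif_pos hy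
  refine ⟨fun y => if h : y ∈ G⟮x⟯ then (ε ⟨y, h⟩ : U) else 0, ⟨?_, ?_⟩, ?_, ?_⟩
  · intro y hy z hz
    rw [hδ hy, hδ hz, hδ (add_mem hy hz), ← IntermediateField.coe_add]
    congr 1
    change _ * φ (d (⟨y, hy⟩ + ⟨z, hz⟩)) = _
    rw [map_add, map_add, mul_add]
  · intro y hy z hz
    rw [hδ hy, hδ hz, hδ (mul_mem hy hz)]
    have : ε (⟨y, hy⟩ * ⟨z, hz⟩) = ⟨y, hy⟩ * ε ⟨z, hz⟩ + ⟨z, hz⟩ * ε ⟨y, hy⟩ := by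
      simp only [ε, d.leibniz, map_add, map_smul, smul_eq_mul]
      ring
    exact congrArg Subtype.val this
  · intro y hy
    beta_reduce
    have hy' : y ∈ G⟮x⟯ := IntermediateField.algebraMap_mem G⟮x⟯ (⟨y, hy⟩ : G)
    rw [hδ hy']
    have : d ⟨y, hy'⟩ = 0 := d.map_algebraMap (⟨y, hy⟩ : G)
    simp [ε, this]
  · beta_reduce
    rw [hδ (mem_adjoin_simple_self G x)]
    have : ε g = 1 := inv_mul_cancel₀ hφ
    exact congrArg Subtype.val this

end DerivationsOn

/-! ### Iterated derivatives and the structure of K⟨A⟩ -/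

namespace DiffField

variable {m : ℕ} {U : Type*} [Field U] [DiffField m U]

theorem der_iterate_comm (i k : Fin m) (n : ℕ) (y : U) :
    der i ((der (m := m) k)^[n] y) = (der (m := m) k)^[n] (der i y) :=
  Function.Commute.iterate_right (f := der (m := m) (K := U) i) (g := der k)
    (fun y => der_comm i k y) n y

/-- Stated for any list without repetition so that induction applies: the extra ∂ᵢ appears at the
single occurrence of i and commutes outwards. -/
theorem foldr_add_single (i : Fin m) (α : Fin m → ℕ) (x : U) (l : List (Fin m)) (hl : l.Nodup) :
    l.foldr (fun k y => (der (m := m) k)^[(α + Pi.single i 1 : Fin m → ℕ) k] y) x =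
      if i ∈ l then der i (l.foldr (fun k y => (der (m := m) k)^[α k] y) x)
      else l.foldr (fun k y => (der (m := m) k)^[α k] y) x := by
  induction l with
  | nil => simp
  | cons k l ih =>
    rw [List.nodup_cons] at hl
    rw [List.foldr_cons, List.foldr_cons, ih hl.2]
    rcases eq_or_ne i k with rfl | hik
    · rw [if_neg hl.1, if_pos (by simp), Pi.add_apply, Pi.single_eq_same,
        Function.iterate_succ_apply']
    · have h1 : (α + Pi.single i 1 : Fin m → ℕ) k = α k := by simp [hik.symm]
      rw [h1]
      by_cases hil : i ∈ l
      · rw [if_pos hil, if_pos (by simp [hil]), der_iterate_comm]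
      · rw [if_neg hil, if_neg (by simp [hil, hik])]

theorem der_iterDer (i : Fin m) (α : Fin m → ℕ) (x : U) :
    der i (iterDer α x) = iterDer (α + Pi.single i 1) x := by
  rw [iterDer, iterDer, foldr_add_single i α x _ (List.nodup_finRange m),
    if_pos (List.mem_finRange i)]

theorem iterDer_zero (x : U) : iterDer (m := m) 0 x = x := by
  rw [iterDer]
  induction List.finRange m with
  | nil => rfl
  | cons k l ih => rw [List.foldr_cons, ih]; rfl

end DiffField

namespace DiffSubfield

open DiffField

variable {m : ℕ} {U : Type*} [Field U] [DiffField m U] (K : DiffSubfield m U) (A : Set U)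

/-- The family of all derivatives of the elements of `A`. -/
noncomputable def derivatives (m : ℕ) {U : Type*} [Field U] [DiffField m U] (A : Set U)
    (q : (Fin m → ℕ) × A) : U :=
  iterDer q.1 (q.2 : U)

theorem der_derivatives (i : Fin m) (q : (Fin m → ℕ) × A) :
    der i (derivatives m A q) = derivatives m A (q.1 + Pi.single i 1, q.2) :=
  der_iterDer i q.1 _

theorem le_adjoin : K.toSubfield ≤ (K.adjoin A).toSubfield :=
  le_sInf fun _ hE => hE.1

theorem subset_adjoin : A ⊆ (K.adjoin A).toSubfield := fun _ hx =>
  Subfield.mem_sInf.2 fun _ hE => hE.2.1 hx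

theorem iterDer_mem (F : DiffSubfield m U) (α : Fin m → ℕ) {x : U} (hx : x ∈ F.toSubfield) :
    iterDer α x ∈ F.toSubfield := by
  rw [iterDer]
  induction List.finRange m with
  | nil => exact hx
  | cons k l ih =>
    rw [List.foldr_cons]
    induction α k with
    | zero => exact ih
    | succ n ih' =>
      rw [Function.iterate_succ_apply']
      exact F.der_mem' k ih'

theorem derivatives_mem_adjoin (q : (Fin m → ℕ) × A) :
    derivatives m A q ∈ (K.adjoin A).toSubfield :=
  (K.adjoin A).iterDer_mem q.1 (K.subset_adjoin A q.2.2)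

/-- The elements of a subfield with derivative in this subfield. -/
def _root_.Subfield.derMem (E : Subfield U) (D : Derivation ℤ U U) : Subfield U where
  carrier := {x | x ∈ E ∧ D x ∈ E}
  mul_mem' := fun {x y} hx hy => ⟨E.mul_mem hx.1 hy.1, by
    rw [D.leibniz]
    exact E.add_mem (E.mul_mem hx.1 hy.2) (E.mul_mem hy.1 hx.2)⟩
  one_mem' := ⟨E.one_mem, by rw [D.map_one_eq_zero]; exact E.zero_mem⟩
  add_mem' := fun {x y} hx hy => ⟨E.add_mem hx.1 hy.1, by
    rw [map_add]
    exact E.add_mem hx.2 hy.2⟩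
  zero_mem' := ⟨E.zero_mem, by rw [map_zero]; exact E.zero_mem⟩
  neg_mem' := fun {x} hx => ⟨E.neg_mem hx.1, by
    rw [map_neg]
    exact E.neg_mem hx.2⟩
  inv_mem' := fun x hx => ⟨E.inv_mem hx.1, by
    rw [D.leibniz_inv]
    exact E.mul_mem (E.neg_mem (E.pow_mem (E.inv_mem hx.1) 2)) hx.2⟩

/-- Closure of the compositum under a derivation can be tested on generators, where it only shifts
the index of a derivative. -/
theorem adjoin_toSubfield : (K.adjoin A).toSubfield =
    K.toSubfield ⊔ Subfield.closure (Set.range (derivatives m A)) := by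
  set E := K.toSubfield ⊔ Subfield.closure (Set.range (derivatives m A)) with hE
  have hx : ∀ q, derivatives m A q ∈ E := fun q =>
    (le_sup_right : _ ≤ E) (Subfield.subset_closure ⟨q, rfl⟩)
  apply le_antisymm
  · refine sInf_le ⟨le_sup_left, fun a ha => ?_, fun i x hxE => ?_⟩
    · have := hx (0, ⟨a, ha⟩)
      rwa [derivatives, iterDer_zero] at this
    · have : E ≤ E.derMem (der i) := by
        conv_lhs => rw [hE]
        refine sup_le (fun y hy => ⟨(le_sup_left : _ ≤ E) hy, (le_sup_left : _ ≤ E) (K.der_mem' i hy)⟩)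
          (Subfield.closure_le.2 ?_)
        rintro _ ⟨q, rfl⟩
        exact ⟨hx q, by rw [der_derivatives]; exact hx _⟩
      exact (this hxE).2
  · refine sup_le (K.le_adjoin A) (Subfield.closure_le.2 ?_)
    rintro _ ⟨q, rfl⟩
    exact K.derivatives_mem_adjoin A q

variable {A}

/-- A separably differentially independent set has dual derivations. -/
theorem IsSepDiffIndependent.exists_dual (hA : K.IsSepDiffIndependent A) :
    ∃ δ : (Fin m → ℕ) × A → U → U, (∀ q, IsDerivationOn (K.adjoin A).toSubfield (δ q)) ∧
      (∀ q, ∀ y ∈ K.toSubfield, δ q y = 0) ∧ (∀ q, δ q (derivatives m A q) = 1) ∧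
      ∀ q r, r ≠ q → δ q (derivatives m A r) = 0 := by
  have key : ∀ q, ∃ δ : U → U, IsDerivationOn (K.adjoin A).toSubfield δ ∧
      (∀ y ∈ K.toSubfield, δ y = 0) ∧ δ (derivatives m A q) = 1 ∧
      ∀ r, r ≠ q → δ (derivatives m A r) = 0 := by
    intro q
    obtain ⟨δ, h1, h2, h3⟩ := exists_isDerivationOn_of_not_isSeparable (hA q)
    have heq : (K.toSubfield ⊔ Subfield.closure (derivatives m A '' {r | r ≠ q})) ⊔
        Subfield.closure {derivatives m A q} = (K.adjoin A).toSubfield := by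
      rw [adjoin_toSubfield, sup_assoc, ← Subfield.closure_union]
      congr 2
      ext y
      constructor
      · rintro (⟨r, -, rfl⟩ | h)
        · exact ⟨r, rfl⟩
        · exact ⟨q, h.symm⟩
      · rintro ⟨r, rfl⟩
        rcases eq_or_ne r q with rfl | h
        · exact Or.inr rfl
        · exact Or.inl ⟨r, h, rfl⟩
    refine ⟨δ, ?_, fun y hy => h2 y ((le_sup_left : K.toSubfield ≤ _) hy), h3, fun r hr => h2 _ ?_⟩
    · rw [← heq]; exact h1
    · exact (le_sup_right : Subfield.closure _ ≤ K.toSubfield ⊔ _)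
        (Subfield.subset_closure ⟨r, hr, rfl⟩)
  choose δ h1 h2 h3 h4 using key
  exact ⟨δ, h1, h2, h3, h4⟩

theorem exists_finset_of_mem_adjoin {y : U} (hy : y ∈ (K.adjoin A).toSubfield) :
    ∃ T : Finset ((Fin m → ℕ) × A), y ∈ K.toSubfield ⊔ Subfield.closure (derivatives m A '' T) := by
  classical
  have hmono : ∀ {S T : Finset ((Fin m → ℕ) × A)}, S ⊆ T →
      K.toSubfield ⊔ Subfield.closure (derivatives m A '' S) ≤
        K.toSubfield ⊔ Subfield.closure (derivatives m A '' T) := fun h =>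
    sup_le_sup_left (Subfield.closure_mono (Set.image_mono (Finset.coe_subset.2 h))) _
  rw [adjoin_toSubfield] at hy
  rw [← Subfield.closure_eq K.toSubfield, ← Subfield.closure_union] at hy
  induction hy using Subfield.closure_induction with
  | mem x hx =>
    rcases hx with hx | ⟨q, rfl⟩
    · exact ⟨∅, (le_sup_left : K.toSubfield ≤ _) hx⟩
    · exact ⟨{q}, (le_sup_right : Subfield.closure _ ≤ K.toSubfield ⊔ _)
        (Subfield.subset_closure ⟨q, by simp, rfl⟩)⟩
  | one => exact ⟨∅, Subfield.one_mem _⟩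
  | add x y _ _ hx hy =>
    obtain ⟨S, hS⟩ := hx
    obtain ⟨T, hT⟩ := hy
    exact ⟨S ∪ T, Subfield.add_mem _ (hmono Finset.subset_union_left hS)
      (hmono Finset.subset_union_right hT)⟩
  | neg x _ hx => exact hx.imp fun _ h => Subfield.neg_mem _ h
  | inv x _ hx => exact hx.imp fun _ h => Subfield.inv_mem _ h
  | mul x y _ _ hx hy =>
    obtain ⟨S, hS⟩ := hx
    obtain ⟨T, hT⟩ := hy
    exact ⟨S ∪ T, Subfield.mul_mem _ (hmono Finset.subset_union_left hS)
      (hmono Finset.subset_union_right hT)⟩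

/-- Constants of `K⟨A⟩` lie in the compositum of `K` and the `p`-th powers. -/
theorem IsSepDiffIndependent.constants_le (p : ℕ) [Fact p.Prime] [CharP U p] (hm : 1 ≤ m)
    (hA : K.IsSepDiffIndependent A) {c : U} (hc : c ∈ (K.adjoin A).toSubfield)
    (hcd : ∀ i : Fin m, der i c = 0) :
    c ∈ K.toSubfield ⊔ (K.adjoin A).toSubfield.pthPowers p := by
  classical
  set F := (K.adjoin A).toSubfield with hF
  obtain ⟨δ, hδ, hδK, hδ1, hδ0⟩ := hA.exists_dual
  obtain ⟨T, hT⟩ := K.exists_finset_of_mem_adjoin hc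
  have hxF := K.derivatives_mem_adjoin A
  have hout : ∀ q ∉ T, δ q c = 0 := by
    intro q hq
    have : K.toSubfield ⊔ Subfield.closure (derivatives m A '' T) ≤ (hδ q).ker := by
      refine sup_le (fun y hy => ⟨K.le_adjoin A hy, hδK q y hy⟩) (Subfield.closure_le.2 ?_)
      rintro _ ⟨r, hr, rfl⟩
      exact ⟨hxF r, hδ0 q r fun h => hq (h ▸ hr)⟩
    exact (this hT).2
  -- One derivation is enough to shift indices; its existence is where m ≥ 1 is needed.
  let i : Fin m := ⟨0, hm⟩
  -- The difference of the two sides is a derivation on F, so it vanishes once it does on K and on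
  -- the derivatives of A.
  have hcomm : ∀ (α : Fin m → ℕ) (a : A), ∀ y ∈ F,
      δ (α + Pi.single i 1, a) (der i y) - der i (δ (α + Pi.single i 1, a) y) = δ (α, a) y := by
    intro α a
    set q : (Fin m → ℕ) × A := (α + Pi.single i 1, a) with hq
    have hd : ∀ y ∈ F, der i y ∈ F := fun y hy => (K.adjoin A).der_mem' i hy
    have hε : IsDerivationOn F
        (fun y => δ q (der i y) - der i (δ q y) - δ (α, a) y) := by
      constructor
      · intro x hx y hy
        simp only [map_add, (hδ q).add _ (hd x hx) _ (hd y hy), (hδ q).add _ hx _ hy,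
          (hδ (α, a)).add _ hx _ hy]
        ring
      · intro x hx y hy
        simp only [Derivation.leibniz, smul_eq_mul,
          (hδ q).add _ (F.mul_mem hx (hd y hy)) _ (F.mul_mem hy (hd x hx)),
          (hδ q).mul _ hx _ (hd y hy), (hδ q).mul _ hy _ (hd x hx), (hδ q).mul _ hx _ hy,
          (hδ (α, a)).mul _ hx _ hy, map_add]
        ring
    have hle : F ≤ hε.ker := by
      conv_lhs => rw [hF, adjoin_toSubfield]
      refine sup_le (fun y hy => ⟨K.le_adjoin A hy, ?_⟩) (Subfield.closure_le.2 ?_)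
      · simp only [hδK _ y hy, hδK _ _ (K.der_mem' i hy), map_zero, sub_zero]
      · rintro _ ⟨r, rfl⟩
        refine ⟨hxF r, ?_⟩
        have hr0 : der i (δ q (derivatives m A r)) = 0 := by
          rcases eq_or_ne r q with rfl | h
          · rw [hδ1, Derivation.map_one_eq_zero]
          · rw [hδ0 q r h, map_zero]
        simp only [hr0, der_derivatives, sub_zero]
        rcases eq_or_ne r (α, a) with rfl | h
        · rw [hδ1, hδ1, sub_self]
        · rw [hδ0 _ _ h, hδ0, sub_self]
          intro h'
          rw [hq, Prod.mk.injEq, add_left_inj] at h'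
          exact h (Prod.ext h'.1 h'.2)
    exact fun y hy => sub_eq_zero.1 (hle hy).2
  have hstep : ∀ (α : Fin m → ℕ) (a : A), δ (α + Pi.single i 1, a) c = 0 → δ (α, a) c = 0 := by
    intro α a h
    rw [← hcomm α a c hc, h, hcd, (hδ _).map_zero, map_zero, sub_zero]
  have hall : ∀ q, δ q c = 0 := by
    rintro ⟨α, a⟩
    -- Shift α in direction i until it leaves the finite set T, where δ kills c, then descend by
    -- `hstep`.
    obtain ⟨N, hN⟩ : ∃ N : ℕ, (α + Pi.single i N, a) ∉ T := by
      by_contra! H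
      refine (Set.infinite_range_of_injective (f := fun N : ℕ => (α + Pi.single i N, a)) ?_)
        (T.finite_toSet.subset ?_)
      · intro M N h
        simpa using congrFun (congrArg Prod.fst h) i
      · rintro _ ⟨N, rfl⟩
        exact H N
    have hdesc : ∀ N : ℕ, δ (α + Pi.single i N, a) c = 0 → δ (α, a) c = 0 := by
      intro N
      induction N with
      | zero => simp
      | succ N ih =>
        intro h
        refine ih (hstep _ a ?_)
        rwa [add_assoc, ← Pi.single_add]
    exact hdesc N (hout _ hN)
  set G := K.toSubfield ⊔ F.pthPowers p with hG
  have hGF : G ≤ F := by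
    refine sup_le (K.le_adjoin A) ?_
    rintro _ ⟨y, hy, rfl⟩
    exact F.pow_mem hy p
  have hGδ : ∀ q, G ≤ (hδ q).ker := by
    intro q
    refine sup_le (fun y hy => ⟨K.le_adjoin A hy, hδK q y hy⟩) ?_
    rintro _ ⟨y, hy, rfl⟩
    refine ⟨F.pow_mem hy p, ?_⟩
    change δ q (y ^ p) = 0
    rw [(hδ q).map_pow hy, CharP.cast_eq_zero, zero_mul, zero_mul]
  have hcT : c ∈ G ⊔ Subfield.closure (derivatives m A '' T) :=
    (sup_le_sup_right le_sup_left _ : _ ≤ G ⊔ _) hT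
  clear hT hout
  induction T using Finset.induction_on with
  | empty => simpa using hcT
  | insert q T hq ih =>
    refine ih ?_
    by_contra hcG
    rw [Finset.coe_insert, Set.image_insert_eq, Set.insert_eq, Set.union_comm,
      Subfield.closure_union, ← sup_assoc] at hcT
    have hxp : derivatives m A q ^ p ∈ G ⊔ Subfield.closure (derivatives m A '' T) :=
      (le_sup_left : G ≤ _) ((le_sup_right : F.pthPowers p ≤ G) ⟨_, hxF q, rfl⟩)
    -- If the generator x_q were needed to express c, exchange would express x_q through c and the
    -- other generators; δ_q kills all of these but δ_q x_q = 1.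
    have hmem := Subfield.mem_sup_closure_of_pow_mem p hxp hcT hcG
    have hle : (G ⊔ Subfield.closure (derivatives m A '' T)) ⊔ Subfield.closure {c} ≤
        (hδ q).ker := by
      refine sup_le (sup_le (hGδ q) (Subfield.closure_le.2 ?_)) (Subfield.closure_le.2 ?_)
      · rintro _ ⟨r, hr, rfl⟩
        exact ⟨hxF r, hδ0 q r fun h => hq (h ▸ hr)⟩
      · rintro _ rfl
        exact ⟨hc, hall q⟩
    have := (hle hmem).2
    rw [hδ1] at this
    exact one_ne_zero this

end DiffSubfield

/-! ### Constants of K⟨A⟩ are p-th powers -/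

namespace DiffSubfield

open DiffField

variable {m : ℕ} {U : Type u} [Field U] [DiffField m U] (K : DiffSubfield m U) {A : Set U}

/-- If `E` is a field of constants containing the constants of `K` and the `p`-th powers of `K`, then
the constants of the compositum of `K` and `E` are in `E`. -/
theorem mem_of_mem_sup_of_constants (p : ℕ) [Fact p.Prime] [CharP U p] (E : Subfield U)
    (hE : ∀ x ∈ E, ∀ i : Fin m, der i x = 0) (hKE : K.constants ≤ E)
    (hKp : ∀ x ∈ K.toSubfield, x ^ p ∈ E) {c : U} (hc : c ∈ K.toSubfield ⊔ E)
    (hcd : ∀ i : Fin m, der i c = 0) : c ∈ E := by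
  classical
  have hp1 : 1 ≤ p := (Fact.out : p.Prime).one_le
  let S : Submodule K.toSubfield U := Submodule.span K.toSubfield (E : Set U)
  have hSmul : ∀ x ∈ S, ∀ y ∈ S, x * y ∈ S := by
    intro x hx y hy
    have h := Submodule.mul_mem_mul hx hy
    rw [Submodule.span_mul_span] at h
    refine Submodule.span_mono ?_ h
    rintro _ ⟨a, ha, b, hb, rfl⟩
    exact E.mul_mem ha hb
  -- The K-span of E is already the compositum: its elements have p-th powers in E, so x⁻¹ = (x ^
  -- p)⁻¹ x ^ (p - 1) stays in the span.
  let S' : Subfield U :=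
    { carrier := {x | x ∈ S ∧ x ^ p ∈ E}
      mul_mem' := fun {x y} hx hy =>
        ⟨hSmul x hx.1 y hy.1, by rw [mul_pow]; exact E.mul_mem hx.2 hy.2⟩
      one_mem' := ⟨Submodule.subset_span E.one_mem, by rw [one_pow]; exact E.one_mem⟩
      add_mem' := fun {x y} hx hy =>
        ⟨S.add_mem hx.1 hy.1, by rw [add_pow_char]; exact E.add_mem hx.2 hy.2⟩
      zero_mem' := ⟨S.zero_mem, by
        rw [zero_pow (Fact.out : p.Prime).ne_zero]; exact E.zero_mem⟩
      neg_mem' := fun {x} hx => ⟨S.neg_mem hx.1, by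
        have := (frobenius U p).map_neg x
        rw [frobenius_def, frobenius_def] at this
        rw [this]; exact E.neg_mem hx.2⟩
      inv_mem' := fun x hx => ⟨by
        rcases eq_or_ne x 0 with rfl | hx0
        · rw [inv_zero]; exact S.zero_mem
        · have h1 : x⁻¹ = (x ^ p)⁻¹ * x ^ (p - 1) := by
            obtain ⟨n, rfl⟩ := Nat.exists_eq_add_of_le' hp1
            rw [Nat.add_sub_cancel, pow_succ]
            field_simp
          have h2 : ∀ n : ℕ, x ^ n ∈ S := by
            intro n
            induction n with
            | zero => rw [pow_zero]; exact Submodule.subset_span E.one_mem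
            | succ n ih => rw [pow_succ]; exact hSmul _ ih _ hx.1
          rw [h1]
          exact hSmul _ (Submodule.subset_span (E.inv_mem hx.2)) _ (h2 _), by
        rw [inv_pow]; exact E.inv_mem hx.2⟩ }
  have hcS : c ∈ S := by
    have : K.toSubfield ⊔ E ≤ S' := by
      refine sup_le (fun x hx => ⟨?_, hKp x hx⟩)
        fun x hx => ⟨Submodule.subset_span hx, E.pow_mem hx p⟩
      have := S.smul_mem (⟨x, hx⟩ : K.toSubfield) (Submodule.subset_span E.one_mem)
      rwa [Subfield.smul_def, smul_eq_mul, mul_one] at this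
    exact (this hc).1
  by_contra hcE
  -- B is a basis of E over the constants of K. If c were outside E, B with c added would be
  -- independent over these constants, hence over K; but c lies in the K-span of B.
  obtain ⟨B, hBE, hBspan, hB⟩ := exists_linearIndependent K.constants (E : Set U)
  have hspanE : ∀ x ∈ Submodule.span K.constants (E : Set U), x ∈ E := by
    intro x hx
    induction hx using Submodule.span_induction with
    | mem x hx => exact hx
    | zero => exact E.zero_mem
    | add x y _ _ hx hy => exact E.add_mem hx hy
    | smul a x _ hx => exact E.mul_mem (hKE a.2) hx
  have hins : LinearIndepOn K.constants id (insert c B) :=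
    LinearIndepOn.id_insert hB fun h => hcE (hspanE c (hBspan ▸ h))
  have hinsK : LinearIndepOn K.toSubfield id (insert c B) := by
    refine linearIndependent_of_constants (m := m) K.toSubfield (fun i x hx => K.der_mem' i hx)
      ?_ ?_
    · rintro i ⟨x, rfl | hx⟩
      · exact hcd i
      · exact hE x (hBE hx) i
    · intro s g hg hsum t ht
      have := linearIndependent_iff'.1 hins s
        (fun t => if h : t ∈ s then ⟨g t, (hg t h).1, fun i => (hg t h).2 i⟩ else 0) (by
          refine (Finset.sum_congr rfl fun t ht => ?_).trans hsum
          rw [dif_pos ht]; rfl) t ht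
      rw [dif_pos ht] at this
      exact congrArg Subtype.val this
  have hcB : c ∉ B := fun h => hcE (hBE h)
  refine ((linearIndepOn_id_insert hcB).1 hinsK).2 ?_
  refine (Submodule.span_le.2 fun x hx => ?_ : S ≤ _) hcS
  have hx' : x ∈ Submodule.span K.constants B := hBspan ▸ Submodule.subset_span hx
  clear hx
  induction hx' using Submodule.span_induction with
  | mem x hx => exact Submodule.subset_span hx
  | zero => exact Submodule.zero_mem _
  | add x y _ _ hx hy => exact Submodule.add_mem _ hx hy
  | smul a x _ hx => exact Submodule.smul_mem _ (⟨a, a.2.1⟩ : K.toSubfield) hx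

/-- The p-th powers of this field already lie in K, so p-independence is taken over K alone.
Maximality makes A with y added dependent: either y lies in K(A), or exchange moves the dependence
from some s in A onto y. -/
theorem pthRoots_constants_le (p : ℕ) [Fact p.Prime] [CharP U p]
    (hA : Subfield.IsPBasis p K.toSubfield (K.constants.pthRoots p) A) :
    K.constants.pthRoots p ≤ K.toSubfield ⊔ Subfield.closure A := by
  classical
  intro y hy
  have hpK : (K.constants.pthRoots p).pthPowers p ≤ K.toSubfield := by
    rintro _ ⟨x, hx, rfl⟩
    exact hx.1
  have hsup : (K.constants.pthRoots p).pthPowers p ⊔ K.toSubfield = K.toSubfield :=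
    sup_eq_right.2 hpK
  have hAsub := hA.prop.1
  have hAind : ∀ s ∈ A, s ∉ K.toSubfield ⊔ Subfield.closure (A \ {s}) := fun s hs => by
    have := hA.prop.2 s hs
    rwa [hsup] at this
  by_cases hyA : y ∈ A
  · exact (le_sup_right : _ ≤ K.toSubfield ⊔ _) (Subfield.subset_closure hyA)
  have hnot : ¬ Subfield.IsPIndependent p K.toSubfield (K.constants.pthRoots p) (insert y A) :=
    fun h => hyA (hA.le_of_ge ⟨Set.insert_subset hy hAsub, h⟩ (Set.subset_insert y A)
      (Set.mem_insert y A))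
  rw [Subfield.IsPIndependent] at hnot
  push Not at hnot
  obtain ⟨s, hs, hmem⟩ := hnot
  rw [hsup] at hmem
  rcases hs with rfl | hs
  · refine (sup_le_sup_left (Subfield.closure_mono ?_) _ : _ ≤ _) hmem
    rintro x ⟨rfl | hx, hxs⟩
    · exact absurd rfl hxs
    · exact hx
  · have hys : y ≠ s := fun h => hyA (h ▸ hs)
    have h1 : s ∈ (K.toSubfield ⊔ Subfield.closure (A \ {s})) ⊔ Subfield.closure {y} := by
      rw [sup_assoc, ← Subfield.closure_union]
      refine (sup_le_sup_left (Subfield.closure_mono ?_) _ : _ ≤ _) hmem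
      rintro x ⟨rfl | hx, hxs⟩
      · exact Or.inr rfl
      · exact Or.inl ⟨hx, hxs⟩
    have hyp : y ^ p ∈ K.toSubfield := hy.1
    have h2 := Subfield.mem_sup_closure_of_pow_mem p ((le_sup_left : K.toSubfield ≤ _) hyp) h1
      (hAind s hs)
    rw [sup_assoc, ← Subfield.closure_union] at h2
    refine (sup_le_sup_left (Subfield.closure_mono ?_) _ : _ ≤ _) h2
    rintro x (hx | rfl)
    · exact hx.1
    · exact hs

/-- Constants of `K⟨A⟩` are `p`-th powers. -/
theorem exists_pow_eq_of_mem_adjoin (p : ℕ) [Fact p.Prime] [CharP U p] (hm : 1 ≤ m)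
    (hU : IsDifferentiallyClosed m U)
    (hA : Subfield.IsPBasis p K.toSubfield (K.constants.pthRoots p) A)
    (hAind : K.IsSepDiffIndependent A) {c : U} (hc : c ∈ (K.adjoin A).toSubfield)
    (hcd : ∀ i : Fin m, der i c = 0) : ∃ y ∈ (K.adjoin A).toSubfield, y ^ p = c := by
  have hle : K.constants ≤ (K.adjoin A).toSubfield.pthPowers p := by
    intro x hx
    obtain ⟨y, rfl⟩ := hU.exists_pow_eq p hx.2
    refine ⟨y, ?_, rfl⟩
    exact (sup_le (K.le_adjoin A) (Subfield.closure_le.2 (K.subset_adjoin A)) : _ ≤ _)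
      (K.pthRoots_constants_le p hA hx)
  have := K.mem_of_mem_sup_of_constants p ((K.adjoin A).toSubfield.pthPowers p) ?_ hle
    (fun x hx => ⟨x, K.le_adjoin A hx, rfl⟩) (hAind.constants_le K p hm hc hcd) hcd
  · obtain ⟨y, hy, rfl⟩ := this
    exact ⟨y, hy, rfl⟩
  · rintro _ ⟨y, -, rfl⟩ i
    rw [frobenius_def, Derivation.leibniz_pow, nsmul_eq_mul, CharP.cast_eq_zero, zero_mul]

end DiffSubfield

/-! ### Definability of K⟨A⟩ over K -/

section Definable

open Set Language

variable {m : ℕ} {U : Type u} [Field U] [DiffField m U]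

theorem definableFun_add {α : Type} {B : Set U} {f g : (α → U) → U}
    (hf : B.DefinableFun (diffRingLanguage m) f) (hg : B.DefinableFun (diffRingLanguage m) g) :
    B.DefinableFun (diffRingLanguage m) fun v => f v + g v := by
  refine DefinableFun.comp (g := fun v => ![f v, g v]) (f := fun w : Fin 2 → U => w 0 + w 1) ?_
    (DefinableFun.of_empty (DefinableFun.fun_symbol (L := diffRingLanguage m) DiffRingFunc.add))
  intro i
  fin_cases i
  · exact hf
  · exact hg

theorem definableFun_mul {α : Type} {B : Set U} {f g : (α → U) → U}
    (hf : B.DefinableFun (diffRingLanguage m) f) (hg : B.DefinableFun (diffRingLanguage m) g) :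
    B.DefinableFun (diffRingLanguage m) fun v => f v * g v := by
  refine DefinableFun.comp (g := fun v => ![f v, g v]) (f := fun w : Fin 2 → U => w 0 * w 1) ?_
    (DefinableFun.of_empty (DefinableFun.fun_symbol (L := diffRingLanguage m) DiffRingFunc.mul))
  intro i
  fin_cases i
  · exact hf
  · exact hg

theorem definableFun_neg {α : Type} {B : Set U} {f : (α → U) → U}
    (hf : B.DefinableFun (diffRingLanguage m) f) :
    B.DefinableFun (diffRingLanguage m) fun v => -f v :=
  DefinableFun.comp (g := fun v => ![f v]) (f := fun w : Fin 1 → U => - w 0)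
    (fun i => by fin_cases i; exact hf)
    (DefinableFun.of_empty (DefinableFun.fun_symbol (L := diffRingLanguage m) DiffRingFunc.neg))

theorem definableFun_der {α : Type} {B : Set U} {f : (α → U) → U} (i : Fin m)
    (hf : B.DefinableFun (diffRingLanguage m) f) :
    B.DefinableFun (diffRingLanguage m) fun v => DiffField.der i (f v) :=
  DefinableFun.comp (g := fun v => ![f v]) (f := fun w : Fin 1 → U => DiffField.der i (w 0))
    (fun i => by fin_cases i; exact hf)
    (DefinableFun.of_empty (DefinableFun.fun_symbol (L := diffRingLanguage m) (DiffRingFunc.der i)))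

theorem definableFun_one {α : Type} {B : Set U} :
    B.DefinableFun (diffRingLanguage m) fun _ : α → U => (1 : U) :=
  DefinableFun.comp (g := fun _ => ![]) (f := fun _ : Fin 0 → U => (1 : U)) (fun i => i.elim0)
    (DefinableFun.of_empty (DefinableFun.fun_symbol (L := diffRingLanguage m) DiffRingFunc.one))

theorem definableFun_zero {α : Type} {B : Set U} :
    B.DefinableFun (diffRingLanguage m) fun _ : α → U => (0 : U) :=
  DefinableFun.comp (g := fun _ => ![]) (f := fun _ : Fin 0 → U => (0 : U)) (fun i => i.elim0)
    (DefinableFun.of_empty (DefinableFun.fun_symbol (L := diffRingLanguage m) DiffRingFunc.zero))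

theorem definableFun_pow {α : Type} {B : Set U} {f : (α → U) → U}
    (hf : B.DefinableFun (diffRingLanguage m) f) (n : ℕ) :
    B.DefinableFun (diffRingLanguage m) fun v => f v ^ n := by
  induction n with
  | zero => simpa using definableFun_one
  | succ n ih => simpa [pow_succ] using definableFun_mul ih hf

/-- An element which is the unique solution of a definable equation is definable. -/
theorem definableFun_const_of_forall_iff {α : Type} {B : Set U} {a : U} {f g : (Option α → U) → U}
    (hf : B.DefinableFun (diffRingLanguage m) f) (hg : B.DefinableFun (diffRingLanguage m) g)
    (h : ∀ v, f v = g v ↔ v none = a) :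
    B.DefinableFun (diffRingLanguage m) fun _ : α → U => a := by
  have := hf.ofPred_eq hg
  simp only [h] at this
  rw [DefinableFun]
  convert this using 1
  ext v
  simp [Function.tupleGraph, eq_comm]

/-- The K-definable elements form a subfield closed under the derivations. It contains A because
Frobenius is injective, so a ∈ A is the only p-th root of a ^ p ∈ K. -/
theorem definableFun_const_of_mem_adjoin (p : ℕ) [Fact p.Prime] [CharP U p]
    (K : DiffSubfield m U) {A : Set U} (hA : A ⊆ K.constants.pthRoots p) {a : U}
    (ha : a ∈ (K.adjoin A).toSubfield) {α : Type} :
    (K.toSubfield : Set U).DefinableFun (diffRingLanguage m) fun _ : α → U => a := by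
  have hvar : ∀ β : Type, (K.toSubfield : Set U).DefinableFun (diffRingLanguage m)
      fun v : Option β → U => v none := fun β => DefinableFun.proj _
  let E : Subfield U :=
    -- All variable types β are allowed at once, since defining an inverse takes one more variable,
    -- in `Option β`.
    { carrier := {c | ∀ β : Type, (K.toSubfield : Set U).DefinableFun (diffRingLanguage m)
        fun _ : β → U => c}
      mul_mem' := fun hx hy β => definableFun_mul (hx β) (hy β)
      one_mem' := fun β => definableFun_one
      add_mem' := fun hx hy β => definableFun_add (hx β) (hy β)
      zero_mem' := fun β => definableFun_zero
      neg_mem' := fun hx β => definableFun_neg (hx β)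
      inv_mem' := fun x hx β => by
        rcases eq_or_ne x 0 with rfl | hx0
        · rw [inv_zero]; exact definableFun_zero
        · exact definableFun_const_of_forall_iff
            (definableFun_mul (hvar β) (hx (Option β))) definableFun_one
            fun v => ⟨eq_inv_of_mul_eq_one_left, fun h => by rw [h, inv_mul_cancel₀ hx0]⟩ }
  have hE : (K.adjoin A).toSubfield ≤ E := by
    refine sInf_le ⟨fun x hx β => definableFun_const _ β hx, fun x hx β => ?_,
      fun i x hx β => definableFun_der i (hx β)⟩
    have hxp : x ^ p ∈ K.toSubfield := (hA hx).1
    refine definableFun_const_of_forall_iff (definableFun_pow (hvar β) p)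
      (definableFun_const _ (Option β) hxp) fun v => ?_
    exact (frobenius_inj U p).eq_iff
  exact hE ha α

/-- Roots of polynomials with definable coefficients are model-theoretically algebraic. -/
theorem mem_acl_of_isAlgebraic {B : Set U} {F : Subfield U}
    (hF : ∀ a ∈ F, B.DefinableFun (diffRingLanguage m) fun _ : Fin 1 → U => a) {b : U}
    (hb : IsAlgebraic F b) : b ∈ (diffRingLanguage m).acl B := by
  obtain ⟨P, hP, hPb⟩ := hb
  refine ⟨{x | Polynomial.aeval x P = 0}, hPb, ?_, ?_⟩
  · refine (P.rootSet_finite U).subset fun x hx => ?_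
    exact (Polynomial.mem_rootSet_of_ne hP).2 hx
  · have h : B.DefinableFun (diffRingLanguage m)
        fun v : Fin 1 → U => Polynomial.aeval (v 0) P := by
      clear hP hPb
      induction P using Polynomial.induction_on' with
      | add P Q hP hQ => simpa using definableFun_add hP hQ
      | monomial n a =>
        simp only [Polynomial.aeval_monomial]
        exact definableFun_mul (hF _ a.2) (definableFun_pow (DefinableFun.proj _) n)
    exact h.ofPred_eq definableFun_zero

end Definable

/-! ### Algebraic elements are separable over F -/

section Acl

open Set Language

variable {m : ℕ} {U : Type u} [Field U] [DiffField m U]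

/-- Model-theoretically algebraic elements over a subset of a differential field `F` are separably
algebraic over `F` when the constants of `F` are `p`-th powers. -/
theorem isSeparable_of_mem_acl (p : ℕ) [Fact p.Prime] [CharP U p]
    (hU : IsDifferentiallyClosed m U) (hsat : (diffRingLanguage m).IsAlephZeroSaturated U)
    (F : DiffSubfield m U)
    (hF : ∀ x ∈ F.toSubfield, (∀ i : Fin m, DiffField.der i x = 0) → ∃ y ∈ F.toSubfield, y ^ p = x)
    {B : Set U} (hB : B ⊆ F.toSubfield) {b : U} (hb : b ∈ (diffRingLanguage m).acl B) :
    IsSeparable F.toSubfield b := by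
  by_contra hsep
  obtain ⟨s, hbs, hfin, hdef⟩ := hb
  obtain ⟨B₀, hB₀, hdef⟩ := definable_iff_finitely_definable.1 hdef
  obtain ⟨φ, hφ⟩ := definable_iff_exists_formula_sum.1 hdef
  have hs : ∀ x : U, x ∈ s ↔ φ.Realize (Sum.elim (fun a : (B₀ : Set U) => (a : U)) fun _ => x) :=
    fun x => by simpa using congrArg ((fun _ : Fin 1 => x) ∈ ·) hφ
  obtain ⟨L, _, _, i, j, hi, hj, hij, hne⟩ := F.exists_amalgam p hF hsep hfin.toFinset
  -- Besides the parameters of φ, d lists the elements of s, so that avoiding s is a quantifier-free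
  -- condition on b'. Only the parameters enter the amalgamated tuple.
  let d : (B₀ : Set U) ⊕ hfin.toFinset → U := Sum.elim (fun a => a) fun a => a
  let c : (B₀ : Set U) ⊕ Fin 1 → U := Sum.elim (fun a => a) fun _ => b
  let g : (B₀ : Set U) ⊕ Fin 1 → ((B₀ : Set U) ⊕ hfin.toFinset) ⊕ Unit :=
    Sum.map Sum.inl fun _ => ()
  have hP : IsQFPred.{u} m (β := ((B₀ : Set U) ⊕ hfin.toFinset) ⊕ Unit)
      (fun M _ _ v => ∀ a : hfin.toFinset, ¬ v (Sum.inr ()) = v (Sum.inl (Sum.inr a))) :=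
    IsQFPred.forall fun a => (isQFPred_eq _ _).not
  obtain ⟨b', hb', hamalg⟩ := hU.exists_diffAmalgam hsat i j hi hj d (j b) c g (by
      rintro (a | a)
      · exact hij _ (hB (hB₀ a.2))
      · rfl) hP (fun a => hne a a.2)
  have hb's : b' ∉ s := fun h => hb' ⟨b', hfin.mem_toFinset.2 h⟩ rfl
  have hiff : φ.Realize c ↔ φ.Realize (fun t => Sum.elim d (fun _ => b') (g t)) := by
    refine DiffAmalgam.realize_iff hU hsat φ (xs := default) (ys := default) ?_
    obtain ⟨L', _, _, i', j', hi', hj', h⟩ := hamalg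
    refine ⟨L', _, _, i', j', hi', hj', ?_⟩
    rintro (t | t)
    · exact h t
    · exact t.elim0
  refine hb's ((hs b').2 ?_)
  convert hiff.1 ((hs b).1 hbs) using 1
  ext (t | t) <;> rfl

end Acl

theorem lemma2p7 (p m : ℕ) [Fact p.Prime] (hm : 1 ≤ m)
    (U : Type u) [Field U] [CharP U p] [DiffField m U]
    (hU : IsDifferentiallyClosed m U)
    (hsat : (diffRingLanguage m).IsAlephZeroSaturated U)
    (K : DiffSubfield m U) (A : Set U)
    (hA : Subfield.IsPBasis p K.toSubfield (K.constants.pthRoots p) A)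
    (hAind : K.IsSepDiffIndependent A) :
    DiffField.IsDifferentiallyPerfect p m (K.adjoin A).toSubfield ∧
      (diffRingLanguage m).acl (K.toSubfield : Set U) =
        (separableClosure (K.adjoin A).toSubfield U : Set U) := by
  have hF : ∀ x ∈ (K.adjoin A).toSubfield, (∀ i : Fin m, DiffField.der i x = 0) →
      ∃ y ∈ (K.adjoin A).toSubfield, y ^ p = x := fun x hx hxd =>
    K.exists_pow_eq_of_mem_adjoin p hm hU hA hAind hx hxd
  refine ⟨DiffField.isDifferentiallyPerfect_of_constants p m _ fun x hx => ?_, ?_⟩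
  · obtain ⟨y, hy, hyx⟩ := hF x x.2 fun i => congrArg Subtype.val (hx i)
    exact ⟨⟨y, hy⟩, Subtype.ext hyx⟩
  · ext b
    rw [SetLike.mem_coe, mem_separableClosure_iff]
    refine ⟨fun h => isSeparable_of_mem_acl p hU hsat (K.adjoin A) hF (K.le_adjoin A) h, fun h => ?_⟩
    exact mem_acl_of_isAlgebraic
      (fun a ha => definableFun_const_of_mem_adjoin p K hA.prop.1 ha) h.isIntegral.isAlgebraic
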